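/- Let $N_r\ge 2$ be an integer and $0\le\alpha<1$. Let $\boldsymbol{H}(1),\boldsymbol{H}(2),\dots$ be a first-order Gauss--Markov Rayleigh channel with $2$ transmit and $N_r$ receive antennas: $\boldsymbol{H}(1)$ and the innovations $\boldsymbol{W}(2),\boldsymbol{W}(3),\dots$ are independent random $N_r\times 2$ matrices, each with independent circularly symmetric complex Gaussian entries of mean zero and unit variance, and $\boldsymbol{H}(k)=\alpha\boldsymbol{H}(k-1)+\sqrt{1-\alpha^2}\,\boldsymbol{W}(k)$ for $k\ge 2$. Let $\mathcal V=\{\boldsymbol{v}_1,\dots,\boldsymbol{v}_n\}$ be a random vector quantization codebook with $n=2^{BK}$ entries ($BK$ bits), that is, the $\boldsymbol{v}_j$ are independent isotropically distributed unit vectors in $\mathbb{C}^2$, independent of the channel. Let $\hat{\boldsymbol{v}}(1)=\arg\max_{\boldsymbol{v}_j\in\mathcal V}\boldsymbol{v}_j^\dagger\boldsymbol{H}(1)^\dagger\boldsymbol{H}(1)\boldsymbol{v}_j$, with any measurable rule for breaking ties, and put $$\gamma_{2\times N_r}(BK)=E\left[\hat{\boldsymbol{v}}(1)^\dagger\boldsymbol{H}(1)^\dagger\boldsymbol{H}(1)\hat{\boldsymbol{v}}(1)\right].$$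 Then for every block $k\ge 1$ the received power is integrable and $$E\left[\hat{\boldsymbol{v}}(1)^\dagger\boldsymbol{H}(k)^\dagger\boldsymbol{H}(k)\hat{\boldsymbol{v}}(1)\right]=\alpha^{2k-2}\left(\gamma_{2\times N_r}(BK)-N_r\right)+N_r ,$$ where $$\begin{aligned}\gamma_{2\times N_r}(BK)=\frac{1}{(N_r-1)!\,(N_r-2)!}\Big[&\phi(N_r+1,N_r-2)-2\phi(N_r,N_r-1)+\phi(N_r-1,N_r)\\&-\frac{1}{2^{BK}+1}\big(\phi(N_r+1,N_r-2)-3\phi(N_r,N_r-1)+3\phi(N_r-1,N_r)-\phi(N_r-2,N_r+1)\big)\Big]\end{aligned}$$ for every function $\phi$ of two nonnegative integers that satisfies the recursion $$\phi(m,n)=mn\,\phi(m-1,n-1)-\frac{(m-n)\,(m+n-1)!}{2^{m+n+1}}\qquad\text{for all } m,n\ge 1$$ with the initial values $\phi(3,0)=\frac{45}{8}$, $\phi(2,1)=\frac{11}{8}$, $\phi(1,2)=\frac58$ and $\phi(0,3)=\frac38$. Such a function exists: $\phi(m,n)=\int_0^\infty x^m e^{-x}\int_0^x y^n e^{-y}\,dy\,dx$,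 $m,n\ge 0$, is one. -/

import Mathlib

open MeasureTheory ProbabilityTheory Set
open scoped Matrix

noncomputable section

/-- Complex matrices carry the product sigma-algebra of their entries. -/
instance instMeasurableSpaceComplexMatrix (a b : ℕ) :
    MeasurableSpace (Matrix (Fin a) (Fin b) ℂ) :=
  inferInstanceAs (MeasurableSpace (Fin a → Fin b → ℂ))

/-- The circularly symmetric complex Gaussian law with mean zero and unit variance: the real and
the imaginary part are independent real Gaussians with mean `0` and variance `1 / 2`. -/
def stdComplexGaussian : Measure ℂ :=
  ((gaussianReal 0 (1 / 2)).prod (gaussianReal 0 (1 / 2))).map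
    (fun p : ℝ × ℝ => (⟨p.1, p.2⟩ : ℂ))

/-- The law of an `Nr × Nt` matrix with independent entries, each of them complex Gaussian with
mean zero and unit variance. -/
def rayleighLaw (Nr Nt : ℕ) : Measure (Matrix (Fin Nr) (Fin Nt) ℂ) :=
  (Measure.pi fun _ : Fin Nr => Measure.pi fun _ : Fin Nt => stdComplexGaussian).map
    (fun f => Matrix.of f)

/-- A law on `ℂ ^ Nt` is that of an isotropically distributed unit vector: it is a probability
measure carried by the unit sphere `v† v = 1` and it is invariant under all unitary matrices. -/
structure IsIsotropicUnit {Nt : ℕ} (μ : Measure (Fin Nt → ℂ)) : Prop where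
  isProbabilityMeasure : IsProbabilityMeasure μ
  unit_norm : ∀ᵐ v ∂μ, star v ⬝ᵥ v = 1
  invariant : ∀ U ∈ Matrix.unitaryGroup (Fin Nt) ℂ, μ.map (fun v => U *ᵥ v) = μ

/-- The received power `v† H† H v` (a real number, read as the real part of that product). -/
def rxPower {Nr Nt : ℕ} (H : Matrix (Fin Nr) (Fin Nt) ℂ) (v : Fin Nt → ℂ) : ℝ :=
  (star v ⬝ᵥ ((Hᴴ * H) *ᵥ v)).re

/-- A first-order Gauss–Markov Rayleigh channel `H 1, H 2, …` with `Nt` transmit and `Nr` receive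
antennas, correlation coefficient `α` and innovations `W 2, W 3, …`, together with a random vector
quantization codebook `V` of `n` independent isotropic unit vectors. The initial channel `H 1`, the
innovations and the codebook are mutually independent. The index of `H` is the block; the value
`H 0` plays no role. -/
structure IsGaussMarkovRVQ {Ω : Type*} [MeasurableSpace Ω] (P : Measure Ω) {Nr Nt n : ℕ} (α : ℝ)
    (H : ℕ → Ω → Matrix (Fin Nr) (Fin Nt) ℂ)
    (W : Ici (2 : ℕ) → Ω → Matrix (Fin Nr) (Fin Nt) ℂ)
    (V : Fin n → Ω → Fin Nt → ℂ) : Prop where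
  measurable_init : Measurable (H 1)
  measurable_innov : ∀ k, Measurable (W k)
  measurable_code : ∀ j, Measurable (V j)
  law_init : P.map (H 1) = rayleighLaw Nr Nt
  law_innov : ∀ k, P.map (W k) = rayleighLaw Nr Nt
  law_code : ∀ j, IsIsotropicUnit (P.map (V j))
  indep_innov : iIndepFun W P
  indep_code : iIndepFun V P
  indep_innov_code : IndepFun (fun ω k => W k ω) (fun ω j => V j ω) P
  indep_init : IndepFun (H 1) (fun ω => ((fun k => W k ω), (fun j => V j ω))) P
  step : ∀ k : Ici (2 : ℕ), ∀ ω,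
    H k ω = (α : ℂ) • H ((k : ℕ) - 1) ω + (Real.sqrt (1 - α ^ 2) : ℂ) • W k ω

/-- A quantization rule: given the channel matrix and the codebook, it selects (measurably, with
any way of breaking ties) the index of a codebook entry of maximal received power. -/
structure IsArgmaxRule {Nr Nt n : ℕ}
    (sel : Matrix (Fin Nr) (Fin Nt) ℂ → (Fin n → Fin Nt → ℂ) → Fin n) : Prop where
  measurable : Measurable (fun p : Matrix (Fin Nr) (Fin Nt) ℂ × (Fin n → Fin Nt → ℂ) =>
    sel p.1 p.2)
  isMax : ∀ (H : Matrix (Fin Nr) (Fin Nt) ℂ) (V : Fin n → Fin Nt → ℂ) (j : Fin n),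
    rxPower H (V j) ≤ rxPower H (V (sel H V))

/-- The quantized beamformer for the first block: the entry of the codebook `V` that the rule `sel`
selects for the channel matrix `H 1`. -/
def quantizedBeamformer {Ω : Type*} {Nr Nt n : ℕ}
    (sel : Matrix (Fin Nr) (Fin Nt) ℂ → (Fin n → Fin Nt → ℂ) → Fin n)
    (H : ℕ → Ω → Matrix (Fin Nr) (Fin Nt) ℂ) (V : Fin n → Ω → Fin Nt → ℂ) (ω : Ω) : Fin Nt → ℂ :=
  V (sel (H 1 ω) (fun j => V j ω)) ω

/-- The recursion, with its initial values, for the doubly indexed function `φ`. -/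
structure IsPhi (φ : ℕ → ℕ → ℝ) : Prop where
  recursion : ∀ m n : ℕ, 1 ≤ m → 1 ≤ n →
    φ m n = m * n * φ (m - 1) (n - 1)
      - ((m : ℝ) - n) * (Nat.factorial (m + n - 1) : ℝ) / 2 ^ (m + n + 1)
  init_three_zero : φ 3 0 = 45 / 8
  init_two_one : φ 2 1 = 11 / 8
  init_one_two : φ 1 2 = 5 / 8
  init_zero_three : φ 0 3 = 3 / 8

/-- The double integral `∫₀^∞ x^m e^{-x} ∫₀^x y^n e^{-y} dy dx`. -/
def phiIntegral (m n : ℕ) : ℝ :=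
  ∫ x in Ioi (0 : ℝ), x ^ m * Real.exp (-x) * ∫ y in (0 : ℝ)..x, y ^ n * Real.exp (-y)

end

/-!
The received power of `v` is `|H v|²`, and everything reduces to unitary invariance.

*The value for the first block.* Fix the channel matrix `H` and let `L ≥ l` be the eigenvalues of
`H† H`. For a unit vector `v` the received power is `l + (L - l) u`, where `u` is the squared modulus
of one coordinate of `v` in an eigenbasis (`exists_unitary_rxPower_eq`). For isotropic `v` in `ℂ²`
the variable `u` is uniform on the unit interval (`lintegral_isotropic_normSq`). The quantizer takes
the largest of `n` independent copies of `u`, which has mean `n / (n + 1)`, so the conditional mean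
of the received power is `L - (L - l) / (n + 1)` (`lintegral_rxPower_codebook`). It remains to
integrate this over `H`. Rotating the first column `h₁` of `H` onto a coordinate axis shows that
`|h₁|²`, `|h₁† h₂|² / |h₁|²` and the rest of `|h₂|²` are independent with Gamma laws
(`lintegral_rayleighLaw_gram`); exchanging the last two for `L` and `l` and integrating out `|h₁|²`
yields the joint density `(L l)^(Nr - 2) (L - l)² e^(-L - l) / ((Nr - 1)! (Nr - 2)!)` on `0 < l < L`
(`lintegral_rayleighLaw_eig`). Against this density, `L - (L - l) / (n + 1)` integrates to a
combination of the double integrals `phiIntegral`. These satisfy the recursion by integration by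
parts in either variable, and the recursion with its four initial values determines all the values
that occur (`IsPhi.eq_on`).

*The later blocks.* The innovation of block `k + 1` is independent of the pair formed by the channel
of block `k` and the beamformer (`indepFun_innovation`). Its law is symmetric, so the cross term in
`|α H v + √(1 - α²) W v|²` averages out, and `E |W v|² = Nr` for unit vectors `v`. Hence the mean
power `e k` satisfies `e (k + 1) = α² e k + (1 - α²) Nr` (`lintegral_rxPower_succ`), which is solved
by the stated geometric interpolation.

Expectations of nonnegative quantities are computed as Lebesgue integrals in `ℝ≥0∞`, so that no
integrability has to be known beforehand; it follows from the finite value.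
-/

namespace RVQ

/-! ### Complex Gaussian vectors and their unitary invariance -/

instance instIsProbabilityMeasureStdComplexGaussian : IsProbabilityMeasure stdComplexGaussian := by
  unfold stdComplexGaussian
  refine Measure.isProbabilityMeasure_map (Measurable.aemeasurable ?_)
  exact Complex.measurableEquivRealProd.symm.measurable

lemma charFun_stdComplexGaussian (t : ℂ) :
    charFun stdComplexGaussian t = Complex.exp (-((Complex.normSq t : ℝ) : ℂ) / 4) := by
  have hm : Measurable (fun p : ℝ × ℝ => (⟨p.1, p.2⟩ : ℂ)) :=
    Complex.measurableEquivRealProd.symm.measurable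
  rw [charFun_apply, stdComplexGaussian, integral_map hm.aemeasurable (by fun_prop)]
  have h : ∀ p : ℝ × ℝ, Complex.exp ((inner ℝ (⟨p.1, p.2⟩ : ℂ) t : ℝ) * Complex.I) =
      Complex.exp (t.re * p.1 * Complex.I) * Complex.exp (t.im * p.2 * Complex.I) := by
    intro p
    rw [← Complex.exp_add]
    congr 1
    simp only [Complex.inner, Complex.mul_re, Complex.conj_re, Complex.conj_im]
    push_cast
    ring
  simp_rw [h]
  rw [integral_prod_mul (fun x : ℝ => Complex.exp (t.re * x * Complex.I))
    (fun x : ℝ => Complex.exp (t.im * x * Complex.I)), ← charFun_apply_real, ← charFun_apply_real,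
    charFun_gaussianReal, charFun_gaussianReal, ← Complex.exp_add]
  congr 1
  rw [Complex.normSq_apply]
  push_cast
  ring

/-- The law of a vector of `m` independent standard complex Gaussians. -/
noncomputable def gaussVec (m : ℕ) : Measure (Fin m → ℂ) := Measure.pi fun _ => stdComplexGaussian

instance instIsProbabilityMeasureGaussVec (m : ℕ) : IsProbabilityMeasure (gaussVec m) := by
  unfold gaussVec; infer_instance

lemma measurable_mulVec {a b : ℕ} (U : Matrix (Fin a) (Fin b) ℂ) :
    Measurable (fun v : Fin b → ℂ => U *ᵥ v) := by
  refine measurable_pi_lambda _ fun i => ?_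
  simp only [Matrix.mulVec, dotProduct]
  fun_prop

/-- A unitary matrix preserves the law of a standard complex Gaussian vector, since it preserves
the characteristic function `exp (-|t|² / 4)`. -/
lemma map_mulVec_gaussVec {m : ℕ} {U : Matrix (Fin m) (Fin m) ℂ}
    (hU : U ∈ Matrix.unitaryGroup (Fin m) ℂ) :
    (gaussVec m).map (fun v => U *ᵥ v) = gaussVec m := by
  have hmeas := measurable_mulVec U
  have hprob : IsProbabilityMeasure ((gaussVec m).map (fun v => U *ᵥ v)) :=
    Measure.isProbabilityMeasure_map hmeas.aemeasurable
  have key : ((gaussVec m).map (fun v => U *ᵥ v)).map (WithLp.toLp 2) =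
      (gaussVec m).map (WithLp.toLp 2 : (Fin m → ℂ) → PiLp 2 (fun _ : Fin m => ℂ)) := by
    have hp1 : IsProbabilityMeasure (((gaussVec m).map (fun v => U *ᵥ v)).map
        (WithLp.toLp 2 : (Fin m → ℂ) → PiLp 2 (fun _ : Fin m => ℂ))) :=
      Measure.isProbabilityMeasure_map (Measurable.aemeasurable (by fun_prop))
    have hp2 : IsProbabilityMeasure ((gaussVec m).map
        (WithLp.toLp 2 : (Fin m → ℂ) → PiLp 2 (fun _ : Fin m => ℂ))) :=
      Measure.isProbabilityMeasure_map (Measurable.aemeasurable (by fun_prop))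
    have hc : ∀ t : PiLp 2 (fun _ : Fin m => ℂ), charFun ((gaussVec m).map (WithLp.toLp 2)) t =
        Complex.exp (-((star t.ofLp ⬝ᵥ t.ofLp).re : ℂ) / 4) := by
      intro t
      rw [gaussVec, charFun_pi]
      simp_rw [charFun_stdComplexGaussian]
      rw [← Complex.exp_sum]
      congr 1
      simp only [dotProduct, Pi.star_apply, Complex.re_sum, Complex.ofReal_sum, RCLike.star_def,
        ← Finset.sum_div, Finset.sum_neg_distrib, Complex.normSq_eq_conj_mul_self.symm,
        Complex.ofReal_re]
    have hc' : ∀ t : PiLp 2 (fun _ : Fin m => ℂ),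
        charFun (((gaussVec m).map (fun v => U *ᵥ v)).map (WithLp.toLp 2)) t =
          charFun ((gaussVec m).map (WithLp.toLp 2)) (WithLp.toLp 2 (Uᴴ *ᵥ t.ofLp)) := by
      intro t
      rw [Measure.map_map (by fun_prop) hmeas, charFun_apply, charFun_apply,
        integral_map (Measurable.aemeasurable (by fun_prop)) (by fun_prop),
        integral_map (Measurable.aemeasurable (by fun_prop)) (by fun_prop)]
      congr 1
      ext x
      have hin : ∀ a b : PiLp 2 (fun _ : Fin m => ℂ),
          inner ℝ a b = (star a.ofLp ⬝ᵥ b.ofLp).re := by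
        intro a b
        simp [PiLp.inner_apply, dotProduct, Complex.inner, Complex.re_sum, mul_comm]
      simp only [hin, Function.comp]
      congr 4
      rw [Matrix.star_mulVec, Matrix.dotProduct_mulVec]
    refine Measure.ext_of_charFun ?_
    ext t
    rw [hc', hc, hc]
    congr 4
    simp only
    rw [Matrix.star_mulVec, Matrix.dotProduct_mulVec, Matrix.vecMul_vecMul,
      Matrix.conjTranspose_conjTranspose, ← Matrix.star_eq_conjTranspose,
      Matrix.mem_unitaryGroup_iff.1 hU, Matrix.vecMul_one]
  have hback : ∀ μ : Measure (Fin m → ℂ),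
      (μ.map (WithLp.toLp 2 : (Fin m → ℂ) → PiLp 2 (fun _ : Fin m => ℂ))).map WithLp.ofLp = μ := by
    intro μ
    rw [Measure.map_map (by fun_prop) (by fun_prop)]
    exact Measure.map_id
  rw [← hback ((gaussVec m).map _), key, hback]

/-- The squared modulus of a standard complex Gaussian is exponentially distributed. -/
lemma lintegral_normSq_stdComplexGaussian {f : ℝ → ENNReal} (hf : Measurable f) :
    ∫⁻ z, f (Complex.normSq z) ∂stdComplexGaussian =
      ∫⁻ x in Ioi (0 : ℝ), ENNReal.ofReal (Real.exp (-x)) * f x := by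
  have hm : Measurable (fun p : ℝ × ℝ => (⟨p.1, p.2⟩ : ℂ)) :=
    Complex.measurableEquivRealProd.symm.measurable
  have hn : Measurable Complex.normSq := Complex.continuous_normSq.measurable
  have hpdf : ∀ x : ℝ, gaussianPDF 0 (1 / 2) x =
      ENNReal.ofReal ((Real.sqrt Real.pi)⁻¹ * Real.exp (-x ^ 2)) := by
    intro x
    rw [gaussianPDF, gaussianPDFReal]
    congr 2
    · push_cast; congr 2; ring
    · congr 1; push_cast; ring
  rw [stdComplexGaussian, lintegral_map (f := fun z => f (Complex.normSq z)) (hf.comp hn) hm,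
    gaussianReal_of_var_ne_zero 0 (by norm_num),
    prod_withDensity (measurable_gaussianPDF _ _) (measurable_gaussianPDF _ _),
    lintegral_withDensity_eq_lintegral_mul _ (by fun_prop) (by fun_prop)]
  -- Pass to polar coordinates, integrate out the angle, and substitute `x = r²` for the radius.
  rw [← Measure.volume_eq_prod, ← lintegral_comp_polarCoord_symm, polarCoord_target,
    Measure.volume_eq_prod, ← Measure.prod_restrict, lintegral_prod _ (by
      refine Measurable.aemeasurable ?_
      have h1 : Measurable (fun a : ℝ × ℝ => polarCoord.symm a) := by
        simp only [polarCoord_symm_apply]; fun_prop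
      simp only [Pi.mul_apply]
      fun_prop)]
  have hinner : ∀ r ∈ Ioi (0 : ℝ), (∫⁻ y in Ioo (-Real.pi) Real.pi, ENNReal.ofReal (r, y).1 •
      ((fun z : ℝ × ℝ => gaussianPDF 0 (1 / 2) z.1 * gaussianPDF 0 (1 / 2) z.2) *
        fun a : ℝ × ℝ => f (Complex.normSq ⟨a.1, a.2⟩)) (polarCoord.symm (r, y))) =
      ENNReal.ofReal |2 * r| * (ENNReal.ofReal (Real.exp (-(r ^ 2))) * f (r ^ 2)) := by
    intro r hr
    have hr' : 0 < r := hr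
    have : ∀ y : ℝ, ENNReal.ofReal (r, y).1 •
      ((fun z : ℝ × ℝ => gaussianPDF 0 (1 / 2) z.1 * gaussianPDF 0 (1 / 2) z.2) *
        fun a : ℝ × ℝ => f (Complex.normSq ⟨a.1, a.2⟩)) (polarCoord.symm (r, y)) =
        ENNReal.ofReal (r * Real.pi⁻¹ * Real.exp (-(r ^ 2))) * f (r ^ 2) := by
      intro y
      simp only [polarCoord_symm_apply, Pi.mul_apply, smul_eq_mul, hpdf, Complex.normSq_mk]
      rw [← mul_assoc, ← ENNReal.ofReal_mul (by positivity), ← ENNReal.ofReal_mul hr'.le]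
      congr 2
      · have h1 : (Real.sqrt Real.pi)⁻¹ * (Real.sqrt Real.pi)⁻¹ = Real.pi⁻¹ := by
          rw [← mul_inv, Real.mul_self_sqrt Real.pi_pos.le]
        calc _ = r * ((Real.sqrt Real.pi)⁻¹ * (Real.sqrt Real.pi)⁻¹) *
              (Real.exp (-(r * Real.cos y) ^ 2) * Real.exp (-(r * Real.sin y) ^ 2)) := by ring
          _ = _ := by
            rw [h1, ← Real.exp_add]
            congr 2
            nlinarith [Real.sin_sq_add_cos_sq y]
      · nlinarith [Real.sin_sq_add_cos_sq y]
    simp_rw [this]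
    rw [lintegral_const, Measure.restrict_apply_univ, Real.volume_Ioo, ← mul_assoc,
      mul_right_comm, ← ENNReal.ofReal_mul (by positivity), ← ENNReal.ofReal_mul (by positivity)]
    congr 2
    rw [abs_of_pos (by positivity)]
    field_simp
    ring
  rw [setLIntegral_congr_fun measurableSet_Ioi hinner]
  have himg : (fun r : ℝ => r ^ 2) '' Ioi 0 = Ioi 0 := by
    ext y
    constructor
    · rintro ⟨x, hx, rfl⟩
      exact pow_pos (show (0 : ℝ) < x from hx) 2
    · intro hy
      exact ⟨Real.sqrt y, Real.sqrt_pos.2 hy, Real.sq_sqrt (le_of_lt hy)⟩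
  rw [← lintegral_image_eq_lintegral_abs_deriv_mul measurableSet_Ioi (f := fun r : ℝ => r ^ 2)
    (f' := fun r => 2 * r) (g := fun x => ENNReal.ofReal (Real.exp (-x)) * f x), himg]
  · intro x _
    simpa using (hasDerivAt_pow 2 x).hasDerivWithinAt
  · intro a ha b hb hab
    exact (pow_left_inj₀ (le_of_lt ha) (le_of_lt hb) two_ne_zero).1 hab

/-! ### Norms of Gaussian vectors and isotropic vectors in `ℂ²` -/

/-- The squared Euclidean norm of a complex vector. -/
def nsq {m : ℕ} (v : Fin m → ℂ) : ℝ := ∑ i, Complex.normSq (v i)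

lemma nsq_nonneg {m : ℕ} (v : Fin m → ℂ) : 0 ≤ nsq v :=
  Finset.sum_nonneg fun _ _ => Complex.normSq_nonneg _

lemma measurable_nsq {m : ℕ} : Measurable (nsq : (Fin m → ℂ) → ℝ) := by
  have := Complex.continuous_normSq.measurable
  unfold nsq
  fun_prop

lemma star_dotProduct_self {m : ℕ} (v : Fin m → ℂ) : star v ⬝ᵥ v = (nsq v : ℂ) := by
  simp [nsq, dotProduct, Complex.normSq_eq_conj_mul_self]

lemma nsq_eq_re {m : ℕ} (v : Fin m → ℂ) : nsq v = (star v ⬝ᵥ v).re := by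
  rw [star_dotProduct_self, Complex.ofReal_re]

lemma nsq_mulVec_unitary {m : ℕ} {U : Matrix (Fin m) (Fin m) ℂ}
    (hU : U ∈ Matrix.unitaryGroup (Fin m) ℂ) (v : Fin m → ℂ) : nsq (U *ᵥ v) = nsq v := by
  rw [nsq_eq_re, nsq_eq_re, Matrix.star_mulVec, Matrix.dotProduct_mulVec, Matrix.vecMul_vecMul,
    ← Matrix.star_eq_conjTranspose, Matrix.mem_unitaryGroup_iff'.1 hU, Matrix.vecMul_one]

/-- Some unitary matrix rotates a given vector `v` onto the first coordinate axis. The conclusion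
is multiplied through by the squared norm of `v`, so that it also holds for `v = 0`. -/
lemma exists_unitary_normSq_mulVec_zero {m : ℕ} (v : Fin (m + 1) → ℂ) :
    ∃ U ∈ Matrix.unitaryGroup (Fin (m + 1)) ℂ, ∀ x : Fin (m + 1) → ℂ,
      Complex.normSq ((U *ᵥ x) 0) * nsq v = Complex.normSq (star v ⬝ᵥ x) := by
  rcases eq_or_ne v 0 with rfl | hv
  · exact ⟨1, one_mem _, fun x => by simp [nsq]⟩
  set w : EuclideanSpace ℂ (Fin (m + 1)) := WithLp.toLp 2 v with hw
  have hw0 : w ≠ 0 := fun h => hv (by simpa [hw] using congrArg WithLp.ofLp h)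
  have hnorm : ‖w‖ ≠ 0 := norm_ne_zero_iff.2 hw0
  have hnw : ‖w‖ ^ 2 = nsq v := by
    rw [EuclideanSpace.norm_sq_eq]
    simp [nsq, hw, Complex.normSq_eq_norm_sq]
  set e : EuclideanSpace ℂ (Fin (m + 1)) := ((‖w‖ : ℂ)⁻¹) • w with he
  have hen : ‖e‖ = 1 := by
    rw [he, norm_smul, norm_inv, Complex.norm_real, norm_norm, inv_mul_cancel₀ hnorm]
  have horth : Orthonormal ℂ (({0} : Set (Fin (m + 1))).domRestrict fun _ => e) := by
    constructor
    · intro i; exact hen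
    · intro i j hij
      exact absurd (Subtype.ext ((mem_singleton_iff.1 i.2).trans (mem_singleton_iff.1 j.2).symm)) hij
  obtain ⟨b, hb⟩ := horth.exists_orthonormalBasis_extension_of_card_eq (by simp)
  have hb0 : b 0 = e := hb 0 rfl
  refine ⟨Matrix.of fun i j => star (b i j), ?_, fun x => ?_⟩
  · rw [Matrix.mem_unitaryGroup_iff]
    ext i k
    have := (orthonormal_iff_ite.1 b.orthonormal) i k
    rw [Matrix.mul_apply, Matrix.one_apply, ← this, PiLp.inner_apply]
    simp [mul_comm]
  · have h1 : (((Matrix.of fun i j => star (b i j)) : Matrix _ _ ℂ) *ᵥ x) 0 =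
        (‖w‖ : ℂ)⁻¹ * (star v ⬝ᵥ x) := by
      simp only [Matrix.mulVec, dotProduct, Matrix.of_apply, hb0, he, Pi.star_apply,
        Finset.mul_sum, PiLp.smul_apply, smul_eq_mul, star_mul']
      refine Finset.sum_congr rfl fun i _ => ?_
      have : star ((‖w‖ : ℂ)⁻¹) = (‖w‖ : ℂ)⁻¹ := by simp
      rw [this, mul_assoc]
    rw [h1, Complex.normSq_mul, ← hnw, Complex.normSq_inv, Complex.normSq_ofReal]
    field_simp

lemma normSq_star_dotProduct_comm {m : ℕ} (v w : Fin m → ℂ) :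
    Complex.normSq (star v ⬝ᵥ w) = Complex.normSq (star w ⬝ᵥ v) := by
  rw [← Complex.normSq_conj (star w ⬝ᵥ v)]
  congr 1
  simp [dotProduct, mul_comm]

/-- Tonelli on the sector `0 < x < s`. -/
lemma lintegral_triangle_swap {G : ℝ → ℝ → ENNReal} (hG : Measurable (Function.uncurry G)) :
    ∫⁻ x in Ioi (0 : ℝ), ∫⁻ s in Ioi x, G x s = ∫⁻ s in Ioi (0 : ℝ), ∫⁻ x in Ioo 0 s, G x s := by
  have hS : MeasurableSet {p : ℝ × ℝ | 0 < p.1 ∧ p.1 < p.2} :=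
    (measurableSet_lt measurable_const measurable_fst).inter
      (measurableSet_lt measurable_fst measurable_snd)
  have h1 : ∫⁻ x in Ioi (0 : ℝ), ∫⁻ s in Ioi x, G x s =
      ∫⁻ x, ∫⁻ s, {p : ℝ × ℝ | 0 < p.1 ∧ p.1 < p.2}.indicator (Function.uncurry G) (x, s) := by
    rw [← lintegral_indicator measurableSet_Ioi]
    refine lintegral_congr fun x => ?_
    by_cases hx : 0 < x
    · rw [indicator_of_mem (mem_Ioi.2 hx), ← lintegral_indicator measurableSet_Ioi]
      refine lintegral_congr fun s => ?_
      simp [indicator, hx]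
    · rw [indicator_of_notMem (by simpa using hx)]
      simp [indicator, hx]
  have h2 : ∫⁻ s in Ioi (0 : ℝ), ∫⁻ x in Ioo 0 s, G x s =
      ∫⁻ s, ∫⁻ x, {p : ℝ × ℝ | 0 < p.1 ∧ p.1 < p.2}.indicator (Function.uncurry G) (x, s) := by
    rw [← lintegral_indicator measurableSet_Ioi]
    refine lintegral_congr fun s => ?_
    by_cases hs : 0 < s
    · rw [indicator_of_mem (mem_Ioi.2 hs), ← lintegral_indicator measurableSet_Ioo]
      refine lintegral_congr fun x => ?_
      simp [indicator]
    · rw [indicator_of_notMem (by simpa using hs)]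
      have : ∀ x : ℝ, ¬ (0 < x ∧ x < s) := fun x hx => hs (hx.1.trans hx.2)
      simp [indicator, this]
  rw [h1, h2]
  exact lintegral_lintegral_swap (hG.indicator hS).aemeasurable

lemma setLIntegral_Ioi_add {g : ℝ → ENNReal} (x : ℝ) :
    ∫⁻ y in Ioi (0 : ℝ), g (x + y) = ∫⁻ s in Ioi x, g s := by
  rw [← lintegral_indicator measurableSet_Ioi, ← lintegral_indicator measurableSet_Ioi,
    ← lintegral_add_left_eq_self ((Ioi x).indicator g) x]
  refine lintegral_congr fun y => ?_
  simp [indicator]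

/-- The change of variables `(x, y) ↦ (x, x + y)` on the positive quadrant. -/
lemma lintegral_add_quadrant {G : ℝ → ℝ → ENNReal} (hG : Measurable (Function.uncurry G)) :
    ∫⁻ x in Ioi (0 : ℝ), ∫⁻ y in Ioi (0 : ℝ), G x (x + y) =
      ∫⁻ s in Ioi (0 : ℝ), ∫⁻ x in Ioo 0 s, G x s := by
  rw [← lintegral_triangle_swap hG]
  exact lintegral_congr fun x => setLIntegral_Ioi_add x

lemma lintegral_gaussVec_succ {m : ℕ} {F : ℂ × (Fin m → ℂ) → ENNReal} (hF : Measurable F) :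
    ∫⁻ z, F (z 0, Fin.tail z) ∂gaussVec (m + 1) =
      ∫⁻ a, ∫⁻ t, F (a, t) ∂gaussVec m ∂stdComplexGaussian := by
  have h := measurePreserving_piFinSuccAbove (fun _ : Fin (m + 1) => stdComplexGaussian) 0
  rw [← lintegral_prod _ hF.aemeasurable]
  exact h.lintegral_comp hF

lemma nsq_succ {m : ℕ} (z : Fin (m + 1) → ℂ) :
    nsq z = Complex.normSq (z 0) + nsq (Fin.tail z) := by
  simp [nsq, Fin.sum_univ_succ, Fin.tail]

lemma lintegral_Ioo_sub_pow (s : ℝ) (hs : 0 < s) (m : ℕ) :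
    ∫⁻ x in Ioo 0 s, ENNReal.ofReal ((s - x) ^ m / m.factorial) =
      ENNReal.ofReal (s ^ (m + 1) / (m + 1).factorial) := by
  rw [restrict_Ioo_eq_restrict_Ioc, ← ofReal_integral_eq_lintegral_ofReal]
  · rw [← intervalIntegral.integral_of_le hs.le, intervalIntegral.integral_div,
      intervalIntegral.integral_comp_sub_left (fun x => x ^ m)]
    congr 1
    rw [integral_pow, Nat.factorial_succ]
    push_cast
    field_simp
    simp
  · exact (Continuous.integrableOn_Ioc (by fun_prop))
  · refine (ae_restrict_iff' measurableSet_Ioc).2 (ae_of_all _ fun x hx => ?_)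
    have : 0 ≤ s - x := by linarith [hx.2]
    simp only [Pi.zero_apply]
    positivity

/-- The squared norm of a Gaussian vector in `ℂ ^ (m + 1)` is Gamma distributed with shape
`m + 1`. -/
lemma lintegral_nsq_gaussVec (m : ℕ) {f : ℝ → ENNReal} (hf : Measurable f) :
    ∫⁻ z, f (nsq z) ∂gaussVec (m + 1) =
      ∫⁻ x in Ioi (0 : ℝ), ENNReal.ofReal (Real.exp (-x)) *
        (ENNReal.ofReal (x ^ m / m.factorial) * f x) := by
  have hmn := Complex.continuous_normSq.measurable
  have hmq : ∀ k : ℕ, Measurable (nsq : (Fin k → ℂ) → ℝ) := fun k => measurable_nsq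
  induction m generalizing f with
  | zero =>
    have := lintegral_gaussVec_succ (m := 0)
      (F := fun p => f (Complex.normSq p.1 + nsq p.2)) (by fun_prop)
    simp_rw [nsq_succ]
    rw [this]
    simp [nsq, lintegral_normSq_stdComplexGaussian hf]
  | succ m ih =>
    have := lintegral_gaussVec_succ (m := m + 1)
      (F := fun p => f (Complex.normSq p.1 + nsq p.2)) (by fun_prop)
    simp_rw [nsq_succ (m := m + 1)]
    rw [this]
    simp_rw [fun a : ℝ => ih (f := fun y => f (a + y)) (by fun_prop)]
    rw [lintegral_normSq_stdComplexGaussian (f := fun a => ∫⁻ x in Ioi (0 : ℝ),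
      ENNReal.ofReal (Real.exp (-x)) * (ENNReal.ofReal (x ^ m / m.factorial) * f (a + x)))
      (Measurable.lintegral_prod_right (by fun_prop))]
    have hstep : ∀ x ∈ Ioi (0 : ℝ), ENNReal.ofReal (Real.exp (-x)) *
        ∫⁻ y in Ioi (0 : ℝ), ENNReal.ofReal (Real.exp (-y)) *
          (ENNReal.ofReal (y ^ m / m.factorial) * f (x + y)) =
        ∫⁻ y in Ioi (0 : ℝ), (fun x s => ENNReal.ofReal ((s - x) ^ m / m.factorial) *
          (ENNReal.ofReal (Real.exp (-s)) * f s)) x (x + y) := by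
      intro x _
      rw [← lintegral_const_mul _ (by fun_prop)]
      refine lintegral_congr fun y => ?_
      simp only [add_sub_cancel_left, neg_add, Real.exp_add,
        ENNReal.ofReal_mul (Real.exp_pos _).le]
      ring
    rw [setLIntegral_congr_fun measurableSet_Ioi hstep, lintegral_add_quadrant (G := fun x s =>
      ENNReal.ofReal ((s - x) ^ m / m.factorial) * (ENNReal.ofReal (Real.exp (-s)) * f s))
      (by fun_prop)]
    refine setLIntegral_congr_fun measurableSet_Ioi fun s hs => ?_
    rw [lintegral_mul_const _ (by fun_prop), lintegral_Ioo_sub_pow s hs]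
    ring

lemma lintegral_Ioo_scale {c b : ℝ} (hc : 0 < c) (f : ℝ → ENNReal) :
    ∫⁻ y in Ioo 0 (c * b), f y = ∫⁻ l in Ioo 0 b, ENNReal.ofReal c * f (c * l) := by
  have himg : (fun u : ℝ => c * u) '' Ioo 0 b = Ioo 0 (c * b) := by
    rw [image_mul_left_Ioo hc]; simp
  rw [← himg, lintegral_image_eq_lintegral_abs_deriv_mul measurableSet_Ioo (f' := fun _ => c)
    (fun x _ => by simpa using ((hasDerivAt_id x).const_mul c).hasDerivWithinAt)
    (fun a _ b _ hab => mul_left_cancel₀ hc.ne' hab), abs_of_pos hc]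

lemma lintegral_Ioo_comp_div {s : ℝ} (hs : 0 < s) (h : ℝ → ENNReal) :
    ∫⁻ x in Ioo 0 s, h (x / s) = ENNReal.ofReal s * ∫⁻ u in Ioo (0 : ℝ) 1, h u := by
  have := lintegral_Ioo_scale (b := 1) hs fun x => h (x / s)
  simp only [mul_one, mul_div_cancel_left₀ _ hs.ne'] at this
  rw [this, lintegral_const_mul' _ _ ENNReal.ofReal_ne_top]

/-- For a Gaussian vector in `ℂ²`, the share of the first coordinate in the squared norm is
uniformly distributed on the unit interval. -/
lemma lintegral_gaussVec_two_ratio {h : ℝ → ENNReal} (hh : Measurable h) :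
    ∫⁻ z, h (Complex.normSq (z 0) / nsq z) ∂gaussVec 2 = ∫⁻ u in Ioo (0 : ℝ) 1, h u := by
  have hmn := Complex.continuous_normSq.measurable
  have hmq : ∀ k : ℕ, Measurable (nsq : (Fin k → ℂ) → ℝ) := fun k => measurable_nsq
  have hone : ∫⁻ s in Ioi (0 : ℝ), ENNReal.ofReal (Real.exp (-s)) * ENNReal.ofReal s = 1 := by
    have := lintegral_nsq_gaussVec 1 (f := fun _ => 1) measurable_const
    simpa using this.symm
  have h1 := lintegral_gaussVec_succ (m := 1)
    (F := fun p => h (Complex.normSq p.1 / (Complex.normSq p.1 + nsq p.2))) (by fun_prop)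
  simp_rw [nsq_succ (m := 1)]
  rw [h1]
  simp_rw [fun a : ℝ => lintegral_nsq_gaussVec 0 (f := fun y => h (a / (a + y))) (by fun_prop)]
  simp only [pow_zero, Nat.factorial_zero, Nat.cast_one, div_one, ENNReal.ofReal_one, one_mul]
  rw [lintegral_normSq_stdComplexGaussian (f := fun a => ∫⁻ x in Ioi (0 : ℝ),
      ENNReal.ofReal (Real.exp (-x)) * h (a / (a + x)))
      (Measurable.lintegral_prod_right (by fun_prop))]
  have hstep : ∀ x ∈ Ioi (0 : ℝ), ENNReal.ofReal (Real.exp (-x)) *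
        ∫⁻ y in Ioi (0 : ℝ), ENNReal.ofReal (Real.exp (-y)) * h (x / (x + y)) =
        ∫⁻ y in Ioi (0 : ℝ), (fun x s => ENNReal.ofReal (Real.exp (-s)) * h (x / s)) x (x + y) := by
    intro x _
    rw [← lintegral_const_mul _ (by fun_prop)]
    refine lintegral_congr fun y => ?_
    simp only [neg_add, Real.exp_add, ENNReal.ofReal_mul (Real.exp_pos _).le]
    ring
  rw [setLIntegral_congr_fun measurableSet_Ioi hstep,
    lintegral_add_quadrant (G := fun x s => ENNReal.ofReal (Real.exp (-s)) * h (x / s))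
    (by fun_prop)]
  have hstep2 : ∀ s ∈ Ioi (0 : ℝ), ∫⁻ x in Ioo 0 s, ENNReal.ofReal (Real.exp (-s)) * h (x / s) =
      ENNReal.ofReal (Real.exp (-s)) * ENNReal.ofReal s * ∫⁻ u in Ioo (0 : ℝ) 1, h u := by
    intro s hs
    rw [lintegral_const_mul _ (by fun_prop), lintegral_Ioo_comp_div hs, mul_assoc]
  rw [setLIntegral_congr_fun measurableSet_Ioi hstep2, lintegral_mul_const _ (by fun_prop), hone,
    one_mul]

lemma ae_nsq_pos (m : ℕ) : ∀ᵐ z ∂gaussVec (m + 1), 0 < nsq z := by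
  have hms : MeasurableSet (Iic (0 : ℝ)) := measurableSet_Iic
  have := lintegral_nsq_gaussVec m (f := (Iic (0 : ℝ)).indicator 1)
    (measurable_one.indicator hms)
  rw [setLIntegral_congr_fun measurableSet_Ioi (g := fun _ => 0) (fun x hx => by
    simp [indicator, not_le.2 (show (0 : ℝ) < x from hx)]), lintegral_zero,
    lintegral_eq_zero_iff (f := fun z : Fin (m + 1) → ℂ => (Iic (0 : ℝ)).indicator 1 (nsq z))
      ((measurable_one.indicator hms).comp measurable_nsq)] at this
  filter_upwards [this] with z hz
  by_contra hneg
  simp [indicator, not_lt.1 hneg] at hz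

/-- The squared modulus of the first coordinate of an isotropic unit vector in `ℂ²` is uniformly
distributed on the unit interval. It has the law of the share of the first coordinate in the
squared norm of a Gaussian vector: integrate `|v† g|² / |g|²` over both an isotropic `v` and a
Gaussian `g`, and use the unitary invariance of either law to evaluate the inner integral. -/
lemma lintegral_isotropic_normSq {μ : Measure (Fin 2 → ℂ)} (hμ : IsIsotropicUnit μ)
    {h : ℝ → ENNReal} (hh : Measurable h) :
    ∫⁻ v, h (Complex.normSq (v 0)) ∂μ = ∫⁻ u in Ioo (0 : ℝ) 1, h u := by
  have hp := hμ.isProbabilityMeasure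
  have hmn := Complex.continuous_normSq.measurable
  have hmq : Measurable (nsq : (Fin 2 → ℂ) → ℝ) := measurable_nsq
  have hF : Measurable (fun p : (Fin 2 → ℂ) × (Fin 2 → ℂ) =>
      h (Complex.normSq (star p.1 ⬝ᵥ p.2) / nsq p.2)) := by
    have : Measurable fun p : (Fin 2 → ℂ) × (Fin 2 → ℂ) => star p.1 ⬝ᵥ p.2 := by
      simp only [dotProduct, Pi.star_apply]
      have hs : Measurable (star : ℂ → ℂ) := continuous_star.measurable
      fun_prop
    fun_prop
  have hswap := lintegral_lintegral_swap (μ := μ) (ν := gaussVec 2)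
    (f := fun v g => h (Complex.normSq (star v ⬝ᵥ g) / nsq g)) hF.aemeasurable
  have hl : ∀ᵐ v ∂μ, ∫⁻ g, h (Complex.normSq (star v ⬝ᵥ g) / nsq g) ∂gaussVec 2 =
      ∫⁻ u in Ioo (0 : ℝ) 1, h u := by
    filter_upwards [hμ.unit_norm] with v hv
    have hv1 : nsq v = 1 := by rw [nsq_eq_re, hv, Complex.one_re]
    obtain ⟨U, hU, hrow⟩ := exists_unitary_normSq_mulVec_zero v
    rw [← lintegral_gaussVec_two_ratio hh]
    conv_rhs => rw [← map_mulVec_gaussVec hU]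
    rw [lintegral_map (by fun_prop) (measurable_mulVec U)]
    refine lintegral_congr fun g => ?_
    rw [← hrow, hv1, mul_one, nsq_mulVec_unitary hU]
  have hr : ∀ᵐ g ∂gaussVec 2, ∫⁻ v, h (Complex.normSq (star v ⬝ᵥ g) / nsq g) ∂μ =
      ∫⁻ v, h (Complex.normSq (v 0)) ∂μ := by
    filter_upwards [ae_nsq_pos 1] with g hg
    obtain ⟨U, hU, hrow⟩ := exists_unitary_normSq_mulVec_zero g
    conv_rhs => rw [← hμ.invariant U hU]
    rw [lintegral_map (by fun_prop) (measurable_mulVec U)]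
    refine lintegral_congr fun v => ?_
    rw [normSq_star_dotProduct_comm, ← hrow, mul_div_cancel_right₀ _ hg.ne']
  rw [lintegral_congr_ae hl, lintegral_congr_ae hr] at hswap
  simpa using hswap.symm

/-! ### The best codebook entry for a fixed channel matrix -/

lemma rxPower_eq_nsq {Nr Nt : ℕ} (H : Matrix (Fin Nr) (Fin Nt) ℂ) (v : Fin Nt → ℂ) :
    rxPower H v = nsq (H *ᵥ v) := by
  rw [rxPower, nsq_eq_re, Matrix.star_mulVec, ← Matrix.mulVec_mulVec, Matrix.dotProduct_mulVec]

/-- The difference of the two eigenvalues of `H† H` for a matrix `H` with two columns `h₁`, `h₂`,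
computed from the squared column norms and `|h₁† h₂|²`. -/
noncomputable def gap (a b d : ℝ) : ℝ := Real.sqrt ((a - d) ^ 2 + 4 * b)

/-- The larger eigenvalue of `H† H`, in terms of `a = |h₁|²`, `b = |h₁† h₂|²` and `d = |h₂|²`. -/
noncomputable def eigMax (a b d : ℝ) : ℝ := (a + d + gap a b d) / 2

/-- The smaller eigenvalue of `H† H`, in terms of `a = |h₁|²`, `b = |h₁† h₂|²` and
`d = |h₂|²`. -/
noncomputable def eigMin (a b d : ℝ) : ℝ := (a + d - gap a b d) / 2

open scoped ComplexOrder in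
/-- For Hermitian `2 × 2` matrices `H† H`, the quadratic form on the unit sphere interpolates
between the two eigenvalues, with the squared modulus of one coordinate in an eigenbasis as the
weight. -/
lemma exists_unitary_rxPower_eq {Nr : ℕ} (H : Matrix (Fin Nr) (Fin 2) ℂ) {a b d : ℝ}
    (ha : a = nsq (Hᵀ 0)) (hb : b = Complex.normSq (star (Hᵀ 0) ⬝ᵥ Hᵀ 1)) (hd : d = nsq (Hᵀ 1)) :
    0 ≤ eigMin a b d ∧ ∃ Q ∈ Matrix.unitaryGroup (Fin 2) ℂ, ∀ v : Fin 2 → ℂ, nsq v = 1 →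
      rxPower H v = eigMin a b d + gap a b d * Complex.normSq ((Q *ᵥ v) 0) := by
  have hW : (Hᴴ * H).PosSemidef := Matrix.posSemidef_conjTranspose_mul_self H
  set hA := hW.isHermitian
  set l := hA.eigenvalues with hl
  have h00 : (Hᴴ * H) 0 0 = (a : ℂ) := by
    rw [ha, ← star_dotProduct_self]; rfl
  have h11 : (Hᴴ * H) 1 1 = (d : ℂ) := by
    rw [hd, ← star_dotProduct_self]; rfl
  have h01 : (Hᴴ * H) 0 1 = star (Hᵀ 0) ⬝ᵥ Hᵀ 1 := rfl
  have h10 : (Hᴴ * H) 1 0 = star (star (Hᵀ 0) ⬝ᵥ Hᵀ 1) := by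
    rw [← h01, hA.apply]
  have hsum : l 0 + l 1 = a + d := by
    have := hA.trace_eq_sum_eigenvalues
    rw [Matrix.trace_fin_two, h00, h11, Fin.sum_univ_two] at this
    rw [hl]
    have h2 := congrArg Complex.re this
    simpa using h2.symm
  have hprod : l 0 * l 1 = a * d - b := by
    have := hA.det_eq_prod_eigenvalues
    rw [Matrix.det_fin_two, h00, h11, Fin.prod_univ_two, h01, h10] at this
    rw [RCLike.star_def, Complex.mul_conj, ← hb] at this
    rw [hl]
    have h2 := congrArg Complex.re this
    simpa using h2.symm
  -- The library's eigenvalues come in no particular order relative to the indices `0` and `1`.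
  have hgap : gap a b d = |l 0 - l 1| := by
    rw [gap, ← Real.sqrt_sq_eq_abs]
    congr 1
    linear_combination (a + d + l 0 + l 1) * (-hsum) + 4 * hprod
  have hl0 : ∀ i, 0 ≤ l i := fun i => hW.eigenvalues_nonneg i
  set U : Matrix (Fin 2) (Fin 2) ℂ := (hA.eigenvectorUnitary : Matrix (Fin 2) (Fin 2) ℂ) with hU
  have hUm : U ∈ Matrix.unitaryGroup (Fin 2) ℂ := hA.eigenvectorUnitary.2
  have hUs : star U ∈ Matrix.unitaryGroup (Fin 2) ℂ := Unitary.star_mem hUm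
  have hquad : ∀ v, rxPower H v = l 0 * Complex.normSq ((star U *ᵥ v) 0) +
      l 1 * Complex.normSq ((star U *ᵥ v) 1) := by
    intro v
    have hs := hA.spectral_theorem
    rw [Unitary.conjStarAlgAut_apply, ← hU] at hs
    have h1 : star v ⬝ᵥ ((Hᴴ * H) *ᵥ v) = star (star U *ᵥ v) ⬝ᵥ
        (Matrix.diagonal ((RCLike.ofReal : ℝ → ℂ) ∘ l) *ᵥ (star U *ᵥ v)) := by
      rw [Matrix.star_mulVec, ← Matrix.star_eq_conjTranspose, star_star, ← Matrix.dotProduct_mulVec,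
        Matrix.mulVec_mulVec, Matrix.mulVec_mulVec]
      conv_lhs => rw [hs]
    rw [rxPower, h1]
    simp only [dotProduct, Fin.sum_univ_two, Matrix.mulVec_diagonal, Pi.star_apply,
      Function.comp_apply, Complex.normSq_apply]
    simp
    ring
  have hunit : ∀ v, nsq v = 1 → Complex.normSq ((star U *ᵥ v) 0) +
      Complex.normSq ((star U *ᵥ v) 1) = 1 := by
    intro v hv
    rw [← hv, ← nsq_mulVec_unitary hUs v, nsq, Fin.sum_univ_two]
  rcases le_total (l 1) (l 0) with h | h
  · have hg : gap a b d = l 0 - l 1 := by rw [hgap, abs_of_nonneg (by linarith)]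
    have hmin : eigMin a b d = l 1 := by rw [eigMin, hg]; linarith
    refine ⟨hmin ▸ hl0 1, star U, hUs, fun v hv => ?_⟩
    rw [hquad, hmin, hg]
    linear_combination (l 1) * (hunit v hv)
  · have hg : gap a b d = l 1 - l 0 := by rw [hgap, abs_of_nonpos (by linarith)]; ring
    have hmin : eigMin a b d = l 0 := by rw [eigMin, hg]; linarith
    -- The coordinate that belongs to the larger eigenvalue has to come first.
    have hS : (!![0, 1; 1, 0] : Matrix (Fin 2) (Fin 2) ℂ) ∈ Matrix.unitaryGroup (Fin 2) ℂ := by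
      rw [Matrix.mem_unitaryGroup_iff]
      ext i j
      fin_cases i <;> fin_cases j <;> simp [Matrix.mul_apply]
    refine ⟨hmin ▸ hl0 0, !![0, 1; 1, 0] * star U, mul_mem hS hUs, fun v hv => ?_⟩
    have : ((!![0, 1; 1, 0] * star U) *ᵥ v) 0 = (star U *ᵥ v) 1 := by
      rw [← Matrix.mulVec_mulVec]
      simp [Matrix.mulVec, dotProduct, Fin.sum_univ_two]
    rw [hquad, hmin, hg, this]
    linear_combination (l 0) * (hunit v hv)

lemma lintegral_one_sub_min_pow {n : ℕ} (hn : n ≠ 0) :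
    ∫⁻ t in Ioi (0 : ℝ), (1 - ENNReal.ofReal (min t 1) ^ n) =
      ENNReal.ofReal (n / (n + 1)) := by
  have h1 : ∀ t ∈ Ioi (0 : ℝ), (1 - ENNReal.ofReal (min t 1) ^ n) =
      (Ioc (0 : ℝ) 1).indicator (fun t => ENNReal.ofReal (1 - t ^ n)) t := by
    intro t ht
    have ht0 : (0 : ℝ) < t := ht
    by_cases h : t ≤ 1
    · rw [indicator_of_mem (show t ∈ Ioc (0 : ℝ) 1 from ⟨ht, h⟩), min_eq_left h, ← ENNReal.ofReal_pow ht0.le,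
        ENNReal.ofReal_sub _ (by positivity), ENNReal.ofReal_one]
    · rw [indicator_of_notMem (fun hh : t ∈ Ioc (0 : ℝ) 1 => h hh.2), min_eq_right (not_le.1 h).le]
      simp
  rw [setLIntegral_congr_fun measurableSet_Ioi h1, lintegral_indicator measurableSet_Ioc,
    Measure.restrict_restrict measurableSet_Ioc, inter_eq_left.2 (Ioc_subset_Ioi_self : Ioc (0 : ℝ) 1 ⊆ Ioi 0),
    ← ofReal_integral_eq_lintegral_ofReal]
  · rw [← intervalIntegral.integral_of_le zero_le_one, intervalIntegral.integral_sub
      (by simp) (by simp), integral_pow]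
    congr 1
    simp
    field_simp
    ring
  · exact (Continuous.integrableOn_Ioc (by fun_prop))
  · refine (ae_restrict_iff' measurableSet_Ioc).2 (ae_of_all _ fun x hx => ?_)
    simpa using pow_le_one₀ hx.1.le hx.2

/-- The maximum of `n` independent uniform random variables has mean `n / (n + 1)`. -/
lemma lintegral_sup_normSq {n : ℕ} (hne : (Finset.univ : Finset (Fin n)).Nonempty)
    {μ : Fin n → Measure (Fin 2 → ℂ)} (hμ : ∀ j, IsIsotropicUnit (μ j))
    {Q : Matrix (Fin 2) (Fin 2) ℂ} (hQ : Q ∈ Matrix.unitaryGroup (Fin 2) ℂ) :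
    ∫⁻ V, ENNReal.ofReal (Finset.univ.sup' hne fun j => Complex.normSq ((Q *ᵥ V j) 0))
      ∂Measure.pi μ = ENNReal.ofReal (n / (n + 1)) := by
  have hp : ∀ j, IsProbabilityMeasure (μ j) := fun j => (hμ j).isProbabilityMeasure
  have hmn := Complex.continuous_normSq.measurable
  have hmQ : Measurable fun v : Fin 2 → ℂ => Complex.normSq ((Q *ᵥ v) 0) :=
    hmn.comp ((measurable_pi_apply 0).comp (measurable_mulVec Q))
  have hmS : Measurable fun V : Fin n → Fin 2 → ℂ =>
      Finset.univ.sup' hne fun j => Complex.normSq ((Q *ᵥ V j) 0) :=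
    by
    have := Finset.measurable_sup' hne
      (f := fun (j : Fin n) (V : Fin n → Fin 2 → ℂ) => Complex.normSq ((Q *ᵥ V j) 0))
      (fun j _ => hmQ.comp (measurable_pi_apply j))
    convert this using 1
    ext V
    simp
  rw [lintegral_eq_lintegral_meas_lt _ ?_ hmS.aemeasurable]
  · have hdist : ∀ t ∈ Ioi (0 : ℝ), Measure.pi μ {V | t < Finset.univ.sup' hne fun j =>
        Complex.normSq ((Q *ᵥ V j) 0)} = 1 - ENNReal.ofReal (min t 1) ^ n := by
      intro t ht
      have hcompl : {V : Fin n → Fin 2 → ℂ | t < Finset.univ.sup' hne fun j =>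
          Complex.normSq ((Q *ᵥ V j) 0)} =
          (univ.pi fun _ : Fin n => {v | Complex.normSq ((Q *ᵥ v) 0) ≤ t})ᶜ := by
        ext V
        simp [Finset.lt_sup'_iff]
      have hone : ∀ j, μ j {v | Complex.normSq ((Q *ᵥ v) 0) ≤ t} = ENNReal.ofReal (min t 1) := by
        intro j
        have h1 := lintegral_isotropic_normSq (hμ j) (h := (Iic t).indicator 1)
          (measurable_one.indicator measurableSet_Iic)
        conv_lhs at h1 => rw [← (hμ j).invariant Q hQ]
        rw [lintegral_map (f := fun v : Fin 2 → ℂ => (Iic t).indicator 1 (Complex.normSq (v 0)))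
          ((measurable_one.indicator measurableSet_Iic).comp
          (hmn.comp (measurable_pi_apply 0))) (measurable_mulVec Q),
          lintegral_indicator_one measurableSet_Iic,
          Measure.restrict_apply measurableSet_Iic] at h1
        have h2 : (fun v : Fin 2 → ℂ => (Iic t).indicator (1 : ℝ → ENNReal)
            (Complex.normSq ((Q *ᵥ v) 0))) =
            {v | Complex.normSq ((Q *ᵥ v) 0) ≤ t}.indicator 1 := by
          ext v; simp [indicator]
        rw [h2, lintegral_indicator_one (measurableSet_le hmQ measurable_const)] at h1
        rw [h1]
        rcases le_or_gt 1 t with h | h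
        · rw [inter_eq_right.2 (show Ioo (0 : ℝ) 1 ⊆ Iic t from fun x hx => hx.2.le.trans h),
            min_eq_right h]
          simp
        · have : Iic t ∩ Ioo 0 1 = Ioc 0 t := by
            ext x
            constructor
            · rintro ⟨h1, h2⟩; exact ⟨h2.1, h1⟩
            · rintro ⟨h1, h2⟩; exact ⟨h2, h1, lt_of_le_of_lt h2 h⟩
          rw [this, min_eq_left h.le]
          simp
      rw [hcompl, prob_compl_eq_one_sub (MeasurableSet.univ_pi fun j =>
        measurableSet_le hmQ measurable_const), Measure.pi_pi]
      rw [Finset.prod_congr rfl fun j _ => hone j, Finset.prod_const, Finset.card_univ,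
        Fintype.card_fin]
    rw [setLIntegral_congr_fun measurableSet_Ioi hdist, lintegral_one_sub_min_pow]
    rintro rfl
    simp at hne
  · refine ae_of_all _ fun V => ?_
    obtain ⟨j, hj⟩ := hne
    exact (Complex.normSq_nonneg _).trans (Finset.le_sup' (fun j => Complex.normSq ((Q *ᵥ V j) 0)) hj)

/-- The mean received power, over the random codebook, for a fixed channel matrix. -/
lemma lintegral_rxPower_codebook {Nr n : ℕ}
    {sel : Matrix (Fin Nr) (Fin 2) ℂ → (Fin n → Fin 2 → ℂ) → Fin n} (hsel : IsArgmaxRule sel)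
    {μ : Fin n → Measure (Fin 2 → ℂ)} (hμ : ∀ j, IsIsotropicUnit (μ j))
    (H : Matrix (Fin Nr) (Fin 2) ℂ) {a b d : ℝ} (ha : a = nsq (Hᵀ 0))
    (hb : b = Complex.normSq (star (Hᵀ 0) ⬝ᵥ Hᵀ 1)) (hd : d = nsq (Hᵀ 1)) :
    ∫⁻ V, ENNReal.ofReal (rxPower H (V (sel H V))) ∂Measure.pi μ =
      ENNReal.ofReal (eigMin a b d + gap a b d * (n / (n + 1))) := by
  have hp : ∀ j, IsProbabilityMeasure (μ j) := fun j => (hμ j).isProbabilityMeasure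
  have hne : (Finset.univ : Finset (Fin n)).Nonempty := ⟨sel H 0, Finset.mem_univ _⟩
  obtain ⟨hmin, Q, hQ, hrx⟩ := exists_unitary_rxPower_eq H ha hb hd
  have hg : 0 ≤ gap a b d := Real.sqrt_nonneg _
  have hae : ∀ᵐ V ∂Measure.pi μ, ∀ j, nsq (V j) = 1 := by
    rw [ae_all_iff]
    intro j
    have : ∀ᵐ v ∂μ j, nsq v = 1 := by
      filter_upwards [(hμ j).unit_norm] with v hv
      rw [nsq_eq_re, hv, Complex.one_re]
    exact (Measure.quasiMeasurePreserving_eval μ j).ae this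
  have hval : ∀ᵐ V ∂Measure.pi μ, ENNReal.ofReal (rxPower H (V (sel H V))) =
      ENNReal.ofReal (eigMin a b d) + ENNReal.ofReal (gap a b d) *
        ENNReal.ofReal (Finset.univ.sup' hne fun j => Complex.normSq ((Q *ᵥ V j) 0)) := by
    filter_upwards [hae] with V hV
    rw [← ENNReal.ofReal_mul hg, ← ENNReal.ofReal_add hmin]
    · congr 1
      refine le_antisymm ?_ ?_
      -- The selected index need not maximize the weight itself when the gap is zero, so the
      -- comparison is made between received powers.
      · rw [hrx _ (hV _)]
        gcongr
        exact Finset.le_sup' (fun j => Complex.normSq ((Q *ᵥ V j) 0)) (Finset.mem_univ _)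
      · obtain ⟨j, -, hj⟩ := Finset.exists_mem_eq_sup' hne
          (fun j => Complex.normSq ((Q *ᵥ V j) 0))
        rw [hj, ← hrx _ (hV j)]
        exact hsel.isMax H V j
    · refine mul_nonneg hg ((Complex.normSq_nonneg ((Q *ᵥ V (sel H V)) 0)).trans
        (Finset.le_sup' (fun j => Complex.normSq ((Q *ᵥ V j) 0)) (Finset.mem_univ _)))
  rw [lintegral_congr_ae hval, lintegral_add_left measurable_const,
    lintegral_const_mul' _ _ ENNReal.ofReal_ne_top, lintegral_sup_normSq hne hμ hQ,
    ENNReal.ofReal_add hmin (by positivity), ENNReal.ofReal_mul hg]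
  simp

/-! ### The joint law of the two eigenvalues -/

lemma measurable_gap : Measurable fun p : ℝ × ℝ × ℝ => gap p.1 p.2.1 p.2.2 := by
  unfold gap; fun_prop

lemma measurable_eigMax : Measurable fun p : ℝ × ℝ × ℝ => eigMax p.1 p.2.1 p.2.2 := by
  have := measurable_gap
  unfold eigMax; fun_prop

lemma measurable_eigMin : Measurable fun p : ℝ × ℝ × ℝ => eigMin p.1 p.2.1 p.2.2 := by
  have := measurable_gap
  unfold eigMin; fun_prop

/-- The two columns of an `N × 2` Rayleigh matrix are independent Gaussian vectors. -/
lemma lintegral_rayleighLaw_two {N : ℕ} {F : (Fin N → ℂ) × (Fin N → ℂ) → ENNReal}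
    (hF : Measurable F) :
    ∫⁻ H, F (Hᵀ 0, Hᵀ 1) ∂rayleighLaw N 2 = ∫⁻ h₁, ∫⁻ h₂, F (h₁, h₂) ∂gaussVec N ∂gaussVec N := by
  have hof : Measurable (fun f : Fin N → Fin 2 → ℂ => Matrix.of f) := measurable_id
  have h1 := measurePreserving_pi (fun _ : Fin N => Measure.pi fun _ : Fin 2 => stdComplexGaussian)
    (fun _ => stdComplexGaussian.prod stdComplexGaussian)
    (fun _ => measurePreserving_finTwoArrow stdComplexGaussian)
  have h2 := (measurePreserving_arrowProdEquivProdArrow ℂ ℂ (Fin N) (fun _ => stdComplexGaussian)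
    (fun _ => stdComplexGaussian)).comp h1
  have hmT : Measurable fun H : Matrix (Fin N) (Fin 2) ℂ => F (Hᵀ 0, Hᵀ 1) := by
    refine hF.comp (Measurable.prodMk ?_ ?_)
    · exact measurable_pi_lambda _ fun i => (measurable_pi_apply 0).comp (measurable_pi_apply i)
    · exact measurable_pi_lambda _ fun i => (measurable_pi_apply 1).comp (measurable_pi_apply i)
  rw [rayleighLaw, lintegral_map hmT hof, ← lintegral_prod _ hF.aemeasurable]
  exact h2.lintegral_comp hF

/-- The joint law of the Gram matrix entries of two Gaussian vectors in `ℂ ^ (m + 2)`: rotating the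
first vector onto a coordinate axis splits the squared norm of the second one into an
exponential and an independent Gamma part. -/
lemma lintegral_rayleighLaw_gram (m : ℕ) {G : ℝ × ℝ × ℝ → ENNReal} (hG : Measurable G) :
    ∫⁻ H, G (nsq (Hᵀ 0), Complex.normSq (star (Hᵀ 0) ⬝ᵥ Hᵀ 1), nsq (Hᵀ 1))
        ∂rayleighLaw (m + 2) 2 =
      ∫⁻ a in Ioi (0 : ℝ), ENNReal.ofReal (Real.exp (-a)) *
        (ENNReal.ofReal (a ^ (m + 1) / (m + 1).factorial) *
          ∫⁻ x in Ioi (0 : ℝ), ENNReal.ofReal (Real.exp (-x)) *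
            ∫⁻ y in Ioi (0 : ℝ), ENNReal.ofReal (Real.exp (-y)) *
              (ENNReal.ofReal (y ^ m / m.factorial) * G (a, a * x, x + y))) := by
  have hmn := Complex.continuous_normSq.measurable
  have hmq : ∀ k : ℕ, Measurable (nsq : (Fin k → ℂ) → ℝ) := fun k => measurable_nsq
  have hdot : Measurable fun p : (Fin (m + 2) → ℂ) × (Fin (m + 2) → ℂ) => star p.1 ⬝ᵥ p.2 := by
    simp only [dotProduct, Pi.star_apply]
    have hs : Measurable (star : ℂ → ℂ) := continuous_star.measurable
    fun_prop
  rw [lintegral_rayleighLaw_two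
    (F := fun p => G (nsq p.1, Complex.normSq (star p.1 ⬝ᵥ p.2), nsq p.2)) (by fun_prop)]
  have hinner : ∀ h₁ : Fin (m + 2) → ℂ,
      ∫⁻ h₂, G (nsq h₁, Complex.normSq (star h₁ ⬝ᵥ h₂), nsq h₂) ∂gaussVec (m + 2) =
      (fun a => ∫⁻ x in Ioi (0 : ℝ), ENNReal.ofReal (Real.exp (-x)) *
            ∫⁻ y in Ioi (0 : ℝ), ENNReal.ofReal (Real.exp (-y)) *
              (ENNReal.ofReal (y ^ m / m.factorial) * G (a, a * x, x + y))) (nsq h₁) := by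
    intro h₁
    obtain ⟨U, hU, hrow⟩ := exists_unitary_normSq_mulVec_zero h₁
    have h1 : ∫⁻ h₂, G (nsq h₁, Complex.normSq (star h₁ ⬝ᵥ h₂), nsq h₂) ∂gaussVec (m + 2) =
        ∫⁻ h₂, G (nsq h₁, nsq h₁ * Complex.normSq (h₂ 0), nsq h₂) ∂gaussVec (m + 2) := by
      conv_rhs => rw [← map_mulVec_gaussVec hU]
      rw [lintegral_map (by fun_prop) (measurable_mulVec U)]
      refine lintegral_congr fun h₂ => ?_
      rw [← hrow, nsq_mulVec_unitary hU, mul_comm]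
    have h2 := lintegral_gaussVec_succ (m := m + 1) (F := fun p => G (nsq h₁,
      nsq h₁ * Complex.normSq p.1, Complex.normSq p.1 + nsq p.2)) (by fun_prop)
    rw [h1]
    simp_rw [nsq_succ (m := m + 1)]
    simp_rw [nsq_succ (m := m + 1)] at h2
    rw [h2]
    simp_rw [fun x c : ℝ => lintegral_nsq_gaussVec m (f := fun y => G (c, c * x, x + y))
      (by fun_prop)]
    rw [lintegral_normSq_stdComplexGaussian (f := fun x => ∫⁻ y in Ioi (0 : ℝ),
      ENNReal.ofReal (Real.exp (-y)) * (ENNReal.ofReal (y ^ m / m.factorial) *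
        G (Complex.normSq (h₁ 0) + nsq (Fin.tail h₁),
          (Complex.normSq (h₁ 0) + nsq (Fin.tail h₁)) * x, x + y)))
      (Measurable.lintegral_prod_right (by fun_prop))]
  simp_rw [hinner]
  refine lintegral_nsq_gaussVec (m + 1) (f := fun a => ∫⁻ x in Ioi (0 : ℝ),
    ENNReal.ofReal (Real.exp (-x)) * ∫⁻ y in Ioi (0 : ℝ), ENNReal.ofReal (Real.exp (-y)) *
      (ENNReal.ofReal (y ^ m / m.factorial) * G (a, a * x, x + y))) ?_
  refine Measurable.lintegral_prod_right' (f := fun p : ℝ × ℝ => ENNReal.ofReal (Real.exp (-p.2)) *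
            ∫⁻ y in Ioi (0 : ℝ), ENNReal.ofReal (Real.exp (-y)) *
              (ENNReal.ofReal (y ^ m / m.factorial) * G (p.1, p.1 * p.2, p.2 + y))) ?_
  refine Measurable.mul (by fun_prop) ?_
  exact Measurable.lintegral_prod_right' (f := fun q : (ℝ × ℝ) × ℝ =>
    ENNReal.ofReal (Real.exp (-q.2)) *
      (ENNReal.ofReal (q.2 ^ m / m.factorial) * G (q.1.1, q.1.1 * q.1.2, q.1.2 + q.2)))
    (by fun_prop)

section Substitution

/-! For fixed `a = |h₁|²` and fixed Gamma part `y`, the exponential part `x` is parametrized by the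
larger eigenvalue `L > max a y` as `x = L - a - y + a y / L`; the smaller eigenvalue is then
`a y / L`. -/

variable {a y : ℝ}

lemma gap_subst (ha : 0 < a) {L : ℝ} (haL : a < L) (hyL : y < L) :
    gap a (a * (L - a - y + a * y / L)) (L - a - y + a * y / L + y) = L - a * y / L := by
  have hL : 0 < L := ha.trans haL
  have hle : a * y / L ≤ L := by
    rw [div_le_iff₀ hL]; nlinarith
  rw [gap, show (a - (L - a - y + a * y / L + y)) ^ 2 + 4 * (a * (L - a - y + a * y / L)) =
    (L - a * y / L) ^ 2 by field_simp; ring, Real.sqrt_sq (by linarith)]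

lemma eigMax_subst (ha : 0 < a) {L : ℝ} (haL : a < L) (hyL : y < L) :
    eigMax a (a * (L - a - y + a * y / L)) (L - a - y + a * y / L + y) = L := by
  rw [eigMax, gap_subst ha haL hyL]; ring

lemma eigMin_subst (ha : 0 < a) {L : ℝ} (haL : a < L) (hyL : y < L) :
    eigMin a (a * (L - a - y + a * y / L)) (L - a - y + a * y / L + y) = a * y / L := by
  rw [eigMin, gap_subst ha haL hyL]; ring

lemma image_subst (ha : 0 < a) (hy : 0 < y) :
    (fun L => L - a - y + a * y / L) '' Ioi (max a y) = Ioi 0 := by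
  ext x
  constructor
  · rintro ⟨L, hL, rfl⟩
    obtain ⟨haL, hyL⟩ := max_lt_iff.1 (mem_Ioi.1 hL)
    have hL0 : 0 < L := ha.trans haL
    have : L - a - y + a * y / L = (L - a) * (L - y) / L := by field_simp; ring
    simp only [mem_Ioi]
    rw [this]
    exact div_pos (mul_pos (by linarith) (by linarith)) hL0
  · intro hx
    have hx0 : (0 : ℝ) < x := hx
    have hsq : gap a (a * x) (x + y) ^ 2 = (a - (x + y)) ^ 2 + 4 * (a * x) :=
      Real.sq_sqrt (by positivity)
    have hg0 : 0 ≤ gap a (a * x) (x + y) := Real.sqrt_nonneg _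
    have h1 : a - x - y < gap a (a * x) (x + y) := by
      refine lt_of_pow_lt_pow_left₀ 2 hg0 ?_
      rw [hsq]; nlinarith [mul_pos ha hx0]
    have h2 : y - a - x < gap a (a * x) (x + y) := by
      refine lt_of_pow_lt_pow_left₀ 2 hg0 ?_
      rw [hsq]; nlinarith [mul_pos hy hx0]
    have haL : a < eigMax a (a * x) (x + y) := by rw [eigMax]; linarith
    have hyL : y < eigMax a (a * x) (x + y) := by rw [eigMax]; linarith
    refine ⟨eigMax a (a * x) (x + y), max_lt haL hyL, ?_⟩
    have hL0 : 0 < eigMax a (a * x) (x + y) := ha.trans haL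
    have hroot : eigMax a (a * x) (x + y) ^ 2 + a * y = (a + x + y) * eigMax a (a * x) (x + y) := by
      rw [eigMax]; linear_combination hsq / 4
    field_simp
    linear_combination hroot

lemma lintegral_subst_eigMax (ha : 0 < a) (hy : 0 < y) (f : ℝ → ENNReal) :
    ∫⁻ x in Ioi (0 : ℝ), f x = ∫⁻ L in Ioi (max a y),
      ENNReal.ofReal (1 - a * y / L ^ 2) * f (L - a - y + a * y / L) := by
  rw [← image_subst ha hy, lintegral_image_eq_lintegral_abs_deriv_mul measurableSet_Ioi
    (f' := fun L => 1 - a * y / L ^ 2)]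
  · refine setLIntegral_congr_fun measurableSet_Ioi fun L hL => ?_
    obtain ⟨haL, hyL⟩ := max_lt_iff.1 (mem_Ioi.1 hL)
    have hL0 : 0 < L := ha.trans haL
    have : a * y / L ^ 2 ≤ 1 := by
      rw [div_le_one (by positivity)]; nlinarith
    rw [abs_of_nonneg (by linarith)]
  · intro L hL
    have hL0 : L ≠ 0 := (ha.trans (max_lt_iff.1 (mem_Ioi.1 hL)).1).ne'
    have h := (((hasDerivAt_id L).sub_const a).sub_const y).add
      ((hasDerivAt_inv hL0).const_mul (a * y))
    refine (h.congr_deriv ?_).hasDerivWithinAt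
    field_simp
    ring
  -- The larger eigenvalue is a left inverse of the parametrization.
  · intro L hL L' hL' h
    obtain ⟨haL, hyL⟩ := max_lt_iff.1 (mem_Ioi.1 hL)
    obtain ⟨haL', hyL'⟩ := max_lt_iff.1 (mem_Ioi.1 hL')
    simp only at h
    rw [← eigMax_subst ha haL hyL, h, eigMax_subst ha haL' hyL']

/-- For a fixed value `a` of the first squared column norm, the change of variables from the
exponential and the Gamma part of the second one to the two eigenvalues `L > a > l`. -/
lemma lintegral_eig_of_fixed (m : ℕ) (ha : 0 < a) {g : ℝ × ℝ → ENNReal} (hg : Measurable g) :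
    ∫⁻ x in Ioi (0 : ℝ), ENNReal.ofReal (Real.exp (-x)) *
      ∫⁻ y in Ioi (0 : ℝ), ENNReal.ofReal (Real.exp (-y)) * (ENNReal.ofReal (y ^ m / m.factorial) *
        g (eigMax a (a * x) (x + y), eigMin a (a * x) (x + y))) =
    ∫⁻ L in Ioi a, ∫⁻ l in Ioo 0 a,
      ENNReal.ofReal (Real.exp (a - L - l) * ((L * l / a) ^ m / m.factorial) * ((L - l) / a)) *
        g (L, l) := by
  have hM := measurable_eigMax
  have hm := measurable_eigMin
  have h1 : ∫⁻ x in Ioi (0 : ℝ), ENNReal.ofReal (Real.exp (-x)) *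
      ∫⁻ y in Ioi (0 : ℝ), ENNReal.ofReal (Real.exp (-y)) * (ENNReal.ofReal (y ^ m / m.factorial) *
        g (eigMax a (a * x) (x + y), eigMin a (a * x) (x + y))) =
      ∫⁻ y in Ioi (0 : ℝ), ∫⁻ x in Ioi (0 : ℝ), ENNReal.ofReal (Real.exp (-x)) *
        (ENNReal.ofReal (Real.exp (-y)) * (ENNReal.ofReal (y ^ m / m.factorial) *
        g (eigMax a (a * x) (x + y), eigMin a (a * x) (x + y)))) := by
    simp_rw [← lintegral_const_mul' _ _ ENNReal.ofReal_ne_top]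
    refine lintegral_lintegral_swap (Measurable.aemeasurable ?_)
    unfold Function.uncurry
    fun_prop
  have h2 : ∀ y ∈ Ioi (0 : ℝ), ∫⁻ x in Ioi (0 : ℝ), ENNReal.ofReal (Real.exp (-x)) *
        (ENNReal.ofReal (Real.exp (-y)) * (ENNReal.ofReal (y ^ m / m.factorial) *
        g (eigMax a (a * x) (x + y), eigMin a (a * x) (x + y)))) =
      ∫⁻ L in Ioi y, (Ioi a).indicator (fun L =>
        ENNReal.ofReal ((1 - a * y / L ^ 2) * Real.exp (a - L - a * y / L) *
          (y ^ m / m.factorial)) * g (L, a * y / L)) L := by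
    intro y hy
    have hy0 : (0 : ℝ) < y := hy
    rw [lintegral_subst_eigMax ha hy, lintegral_indicator measurableSet_Ioi,
      Measure.restrict_restrict measurableSet_Ioi, Ioi_inter_Ioi]
    refine setLIntegral_congr_fun measurableSet_Ioi fun L hL => ?_
    obtain ⟨haL, hyL⟩ := max_lt_iff.1 (mem_Ioi.1 hL)
    have hL0 : 0 < L := ha.trans haL
    have h1 : 0 ≤ 1 - a * y / L ^ 2 := by
      rw [sub_nonneg, div_le_one (by positivity)]; nlinarith
    rw [eigMax_subst ha haL hyL, eigMin_subst ha haL hyL,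
      show a - L - a * y / L = -(L - a - y + a * y / L) + -y by ring, Real.exp_add,
      ENNReal.ofReal_mul (by positivity), ENNReal.ofReal_mul h1,
      ENNReal.ofReal_mul (Real.exp_pos _).le]
    ring
  rw [h1, setLIntegral_congr_fun measurableSet_Ioi h2, lintegral_triangle_swap (G := fun y L =>
    (Ioi a).indicator (fun L =>
        ENNReal.ofReal ((1 - a * y / L ^ 2) * Real.exp (a - L - a * y / L) *
          (y ^ m / m.factorial)) * g (L, a * y / L)) L)]
  · have h3 : ∀ L ∈ Ioi (0 : ℝ), ∫⁻ y in Ioo 0 L, (Ioi a).indicator (fun L =>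
        ENNReal.ofReal ((1 - a * y / L ^ 2) * Real.exp (a - L - a * y / L) *
          (y ^ m / m.factorial)) * g (L, a * y / L)) L =
        (Ioi a).indicator (fun L => ∫⁻ l in Ioo 0 a,
          ENNReal.ofReal (Real.exp (a - L - l) * ((L * l / a) ^ m / m.factorial) * ((L - l) / a)) *
          g (L, l)) L := by
      intro L hL
      have hL0 : (0 : ℝ) < L := hL
      by_cases haL : L ∈ Ioi a
      · simp only [indicator_of_mem haL]
        -- Substitute `y = (L / a) l`, where `l` is the smaller eigenvalue.
        have : L = L / a * a := by field_simp
        conv_lhs => rw [this]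
        rw [lintegral_Ioo_scale (div_pos hL0 ha), ← this]
        refine setLIntegral_congr_fun measurableSet_Ioo fun l hl => ?_
        have e1 : a * (L / a * l) / L = l := by field_simp
        have e2 : a * (L / a * l) / L ^ 2 = l / L := by field_simp
        rw [e1, e2, ← mul_assoc, ← ENNReal.ofReal_mul (by positivity)]
        congr 2
        field_simp
      · simp only [indicator_of_notMem haL, lintegral_zero]
    rw [setLIntegral_congr_fun measurableSet_Ioi h3, lintegral_indicator measurableSet_Ioi,
      Measure.restrict_restrict measurableSet_Ioi,
      inter_eq_left.2 (show Ioi a ⊆ Ioi 0 from fun x hx => ha.trans hx)]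
  · have : (Function.uncurry fun y L : ℝ => (Ioi a).indicator (fun L =>
        ENNReal.ofReal ((1 - a * y / L ^ 2) * Real.exp (a - L - a * y / L) *
          (y ^ m / m.factorial)) * g (L, a * y / L)) L) =
        (Prod.snd ⁻¹' Ioi a).indicator (fun p : ℝ × ℝ =>
          ENNReal.ofReal ((1 - a * p.1 / p.2 ^ 2) * Real.exp (a - p.2 - a * p.1 / p.2) *
          (p.1 ^ m / m.factorial)) * g (p.2, a * p.1 / p.2)) := by
      ext p
      simp [Function.uncurry, indicator]
    rw [this]
    exact Measurable.indicator (by fun_prop) (measurable_snd measurableSet_Ioi)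

end Substitution

lemma lintegral_Ioo_Ioo (L : ℝ) {f : ℝ → ENNReal} (hf : Measurable f) :
    ∫⁻ a in Ioo 0 L, ∫⁻ l in Ioo 0 a, f l = ∫⁻ l in Ioo 0 L, ENNReal.ofReal (L - l) * f l := by
  have h := lintegral_triangle_swap (G := fun l a => (Iio L).indicator (fun _ => f l) a) (by
    have : (Function.uncurry fun l a : ℝ => (Iio L).indicator (fun _ => f l) a) =
        (Prod.snd ⁻¹' Iio L).indicator (fun p : ℝ × ℝ => f p.1) := by
      ext p; simp [Function.uncurry, indicator]
    rw [this]
    exact Measurable.indicator (by fun_prop) (measurable_snd measurableSet_Iio))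
  have h1 : ∀ a, ∫⁻ l in Ioo 0 a, (Iio L).indicator (fun _ => f l) a =
      (Iio L).indicator (fun a => ∫⁻ l in Ioo 0 a, f l) a := by
    intro a
    by_cases ha : a ∈ Iio L
    · simp only [indicator_of_mem ha]
    · simp only [indicator_of_notMem ha, lintegral_zero]
  have h2 : ∀ l, ∫⁻ a in Ioi l, (Iio L).indicator (fun _ => f l) a =
      (Iio L).indicator (fun l => ENNReal.ofReal (L - l) * f l) l := by
    intro l
    rw [lintegral_indicator measurableSet_Iio, Measure.restrict_restrict measurableSet_Iio,
      lintegral_const, Measure.restrict_apply_univ, inter_comm, Ioi_inter_Iio, Real.volume_Ioo]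
    by_cases hl : l ∈ Iio L
    · rw [indicator_of_mem hl, mul_comm]
    · rw [indicator_of_notMem hl, ENNReal.ofReal_of_nonpos (by simpa using hl), mul_zero]
  simp_rw [h1, h2] at h
  rw [lintegral_indicator measurableSet_Iio, lintegral_indicator measurableSet_Iio,
    Measure.restrict_restrict measurableSet_Iio, inter_comm, Ioi_inter_Iio] at h
  exact h.symm

lemma measurable_lintegral_Ioo {F : ℝ × ℝ → ENNReal} (hF : Measurable F) :
    Measurable fun p : ℝ × ℝ => ∫⁻ l in Ioo 0 p.1, F (p.2, l) := by
  have h : ∀ p : ℝ × ℝ, ∫⁻ l in Ioo 0 p.1, F (p.2, l) =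
      ∫⁻ l, {q : (ℝ × ℝ) × ℝ | 0 < q.2 ∧ q.2 < q.1.1}.indicator (fun q => F (q.1.2, q.2)) (p, l) := by
    intro p
    rw [← lintegral_indicator measurableSet_Ioo]
    refine lintegral_congr fun l => ?_
    simp [indicator]
  simp_rw [h]
  refine Measurable.lintegral_prod_right (Measurable.indicator (by fun_prop) ?_)
  exact (measurableSet_lt measurable_const measurable_snd).inter
    (measurableSet_lt measurable_snd (by fun_prop))

/-- The joint density of the two eigenvalues `L > l` of `H† H`, for a Rayleigh matrix `H` with two
columns. -/
lemma lintegral_rayleighLaw_eig (m : ℕ) {g : ℝ × ℝ → ENNReal} (hg : Measurable g) :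
    ∫⁻ H, g (eigMax (nsq (Hᵀ 0)) (Complex.normSq (star (Hᵀ 0) ⬝ᵥ Hᵀ 1)) (nsq (Hᵀ 1)),
        eigMin (nsq (Hᵀ 0)) (Complex.normSq (star (Hᵀ 0) ⬝ᵥ Hᵀ 1)) (nsq (Hᵀ 1)))
        ∂rayleighLaw (m + 2) 2 =
      ∫⁻ L in Ioi (0 : ℝ), ∫⁻ l in Ioo 0 L,
        ENNReal.ofReal ((L * l) ^ m * (L - l) ^ 2 * Real.exp (-L - l) /
          ((m + 1).factorial * m.factorial)) * g (L, l) := by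
  have hM := measurable_eigMax
  have hm := measurable_eigMin
  rw [lintegral_rayleighLaw_gram m
    (G := fun p => g (eigMax p.1 p.2.1 p.2.2, eigMin p.1 p.2.1 p.2.2)) (by fun_prop)]
  have h1 : ∀ a ∈ Ioi (0 : ℝ), ENNReal.ofReal (Real.exp (-a)) *
        (ENNReal.ofReal (a ^ (m + 1) / (m + 1).factorial) *
          ∫⁻ x in Ioi (0 : ℝ), ENNReal.ofReal (Real.exp (-x)) *
            ∫⁻ y in Ioi (0 : ℝ), ENNReal.ofReal (Real.exp (-y)) *
              (ENNReal.ofReal (y ^ m / m.factorial) *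
              g (eigMax a (a * x) (x + y), eigMin a (a * x) (x + y)))) =
      ∫⁻ L in Ioi a, (fun a L => ∫⁻ l in Ioo 0 a,
        ENNReal.ofReal ((L * l) ^ m * (L - l) * Real.exp (-L - l) /
          ((m + 1).factorial * m.factorial)) * g (L, l)) a L := by
    intro a ha
    have ha0 : (0 : ℝ) < a := ha
    rw [lintegral_eig_of_fixed m ha0 hg, ← mul_assoc, ← ENNReal.ofReal_mul (Real.exp_pos _).le,
      ← lintegral_const_mul' _ _ ENNReal.ofReal_ne_top]
    refine lintegral_congr fun L => ?_
    rw [← lintegral_const_mul' _ _ ENNReal.ofReal_ne_top]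
    refine lintegral_congr fun l => ?_
    rw [← mul_assoc, ← ENNReal.ofReal_mul (by positivity)]
    congr 2
    rw [show a - L - l = a + (-L - l) by ring, Real.exp_add, Real.exp_neg, div_pow]
    field_simp
    ring
  rw [setLIntegral_congr_fun measurableSet_Ioi h1, lintegral_triangle_swap]
  · refine setLIntegral_congr_fun measurableSet_Ioi fun L _ => ?_
    rw [lintegral_Ioo_Ioo L (f := fun l => ENNReal.ofReal ((L * l) ^ m * (L - l) *
      Real.exp (-L - l) / ((m + 1).factorial * m.factorial)) * g (L, l)) (by fun_prop)]
    refine setLIntegral_congr_fun measurableSet_Ioo fun l hl => ?_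
    rw [← mul_assoc, ← ENNReal.ofReal_mul (by linarith [hl.2])]
    congr 2
    ring
  · exact measurable_lintegral_Ioo (F := fun q : ℝ × ℝ => ENNReal.ofReal ((q.1 * q.2) ^ m *
      (q.1 - q.2) * Real.exp (-q.1 - q.2) / ((m + 1).factorial * m.factorial)) * g (q.1, q.2))
      (by fun_prop)

/-! ### The double integrals `phiIntegral` and the mean received power -/

lemma integrableOn_pow_mul_exp (k : ℕ) {r : ℝ} (hr : 0 < r) :
    IntegrableOn (fun x : ℝ => x ^ k * Real.exp (-(r * x))) (Ioi 0) := by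
  have h := integrableOn_rpow_mul_exp_neg_mul_rpow (p := 1) (s := k) (b := r)
    (by have : (0 : ℝ) ≤ k := k.cast_nonneg
        linarith) one_pos hr
  refine h.congr_fun (fun x _ => ?_) measurableSet_Ioi
  simp

lemma integral_pow_mul_exp (k : ℕ) {r : ℝ} (hr : 0 < r) :
    ∫ x in Ioi (0 : ℝ), x ^ k * Real.exp (-(r * x)) = k.factorial / r ^ (k + 1) := by
  have h := Real.integral_rpow_mul_exp_neg_mul_Ioi (a := k + 1) (by positivity) hr
  rw [Real.Gamma_nat_eq_factorial] at h
  simp only [add_sub_cancel_right, Real.rpow_natCast] at h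
  rw [h, ← Nat.cast_succ, Real.rpow_natCast, one_div, inv_pow]
  rw [Nat.succ_eq_add_one]
  field_simp

/-- The lower incomplete Gamma integral `∫₀^x y^n e^{-y} dy`. -/
noncomputable def lowerGamma (n : ℕ) (x : ℝ) : ℝ := ∫ y in (0 : ℝ)..x, y ^ n * Real.exp (-y)

lemma hasDerivAt_lowerGamma (n : ℕ) (x : ℝ) :
    HasDerivAt (lowerGamma n) (x ^ n * Real.exp (-x)) x :=
  (Continuous.integral_hasStrictDerivAt (by fun_prop) 0 x).hasDerivAt

lemma continuous_lowerGamma (n : ℕ) : Continuous (lowerGamma n) :=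
  continuous_iff_continuousAt.2 fun x => (hasDerivAt_lowerGamma n x).continuousAt

lemma lowerGamma_nonneg (n : ℕ) {x : ℝ} (hx : 0 ≤ x) : 0 ≤ lowerGamma n x :=
  intervalIntegral.integral_nonneg hx fun _ hy => mul_nonneg (pow_nonneg hy.1 _) (Real.exp_pos _).le

lemma lowerGamma_le (n : ℕ) {x : ℝ} (hx : 0 ≤ x) : lowerGamma n x ≤ n.factorial := by
  have h := integral_pow_mul_exp n one_pos
  simp only [one_mul, one_pow, div_one] at h
  have hi := integrableOn_pow_mul_exp n one_pos
  simp only [one_mul] at hi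
  rw [← h, lowerGamma, intervalIntegral.integral_of_le hx]
  refine setIntegral_mono_set hi ?_ (Ioc_subset_Ioi_self.eventuallyLE)
  exact (ae_restrict_iff' measurableSet_Ioi).2 (ae_of_all _ fun y (hy : 0 < y) => by
    simp only [Pi.zero_apply]; positivity)

lemma lowerGamma_succ (n : ℕ) (x : ℝ) :
    lowerGamma (n + 1) x = (n + 1) * lowerGamma n x - x ^ (n + 1) * Real.exp (-x) := by
  have h := intervalIntegral.integral_eq_sub_of_hasDerivAt (a := 0) (b := x)
    (f := fun y : ℝ => y ^ (n + 1) * Real.exp (-y))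
    (f' := fun y => (n + 1) * (y ^ n * Real.exp (-y)) - y ^ (n + 1) * Real.exp (-y))
    (fun y _ => by
      have := (hasDerivAt_pow (n + 1) y).mul ((hasDerivAt_neg y).exp)
      refine this.congr_deriv ?_
      push_cast
      ring)
    (Continuous.intervalIntegrable (by fun_prop) _ _)
  rw [intervalIntegral.integral_sub (Continuous.intervalIntegrable (by fun_prop) _ _)
    (Continuous.intervalIntegrable (by fun_prop) _ _), intervalIntegral.integral_const_mul] at h
  simp only [ne_eq, Nat.add_eq_zero_iff, one_ne_zero, and_false, not_false_eq_true, zero_pow,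
    zero_mul, sub_zero] at h
  unfold lowerGamma
  linarith

lemma phiIntegral_eq (m n : ℕ) :
    phiIntegral m n = ∫ x in Ioi (0 : ℝ), x ^ m * Real.exp (-x) * lowerGamma n x := rfl

lemma integrableOn_phi (m n : ℕ) :
    IntegrableOn (fun x : ℝ => x ^ m * Real.exp (-x) * lowerGamma n x) (Ioi 0) := by
  have hi := integrableOn_pow_mul_exp m one_pos
  simp only [one_mul] at hi
  refine Integrable.mono' (hi.mul_const (n.factorial : ℝ))
    (Continuous.aestronglyMeasurable (by have := continuous_lowerGamma n; fun_prop)) ?_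
  refine (ae_restrict_iff' measurableSet_Ioi).2 (ae_of_all _ fun x (hx : 0 < x) => ?_)
  have h0 := lowerGamma_nonneg n hx.le
  have h1 := lowerGamma_le n hx.le
  rw [Real.norm_of_nonneg (by positivity)]
  gcongr

lemma phiIntegral_succ_right (m n : ℕ) :
    phiIntegral m (n + 1) =
      (n + 1) * phiIntegral m n - (m + n + 1).factorial / 2 ^ (m + n + 2) := by
  rw [phiIntegral_eq, phiIntegral_eq, ← integral_pow_mul_exp (m + n + 1) two_pos,
    ← integral_const_mul, ← integral_sub ((integrableOn_phi m n).const_mul _)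
      (integrableOn_pow_mul_exp (m + n + 1) two_pos)]
  refine setIntegral_congr_fun measurableSet_Ioi fun x _ => ?_
  rw [lowerGamma_succ, two_mul, neg_add, Real.exp_add]
  ring

lemma phiIntegral_succ_left (m n : ℕ) :
    phiIntegral (m + 1) n =
      (m + 1) * phiIntegral m n + (m + n + 1).factorial / 2 ^ (m + n + 2) := by
  have hint := (((integrableOn_phi m n).const_mul (m + 1 : ℝ)).sub (integrableOn_phi (m + 1) n)).add
    (integrableOn_pow_mul_exp (m + n + 1) two_pos)
  have hlim : Filter.Tendsto (fun x : ℝ => x ^ (m + 1) * Real.exp (-x) * lowerGamma n x)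
      Filter.atTop (nhds 0) := by
    have h := (Real.tendsto_pow_mul_exp_neg_atTop_nhds_zero (m + 1)).mul_const (n.factorial : ℝ)
    rw [zero_mul] at h
    refine tendsto_of_tendsto_of_tendsto_of_le_of_le' tendsto_const_nhds h ?_ ?_
    · filter_upwards [Filter.eventually_ge_atTop 0] with x hx
      have h0 := lowerGamma_nonneg n hx
      positivity
    · filter_upwards [Filter.eventually_ge_atTop 0] with x hx
      have h1 := lowerGamma_le n hx
      gcongr
  have h := integral_Ioi_of_hasDerivAt_of_tendsto' (a := 0)
    (f := fun x : ℝ => x ^ (m + 1) * Real.exp (-x) * lowerGamma n x)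
    (f' := fun x => (m + 1) * (x ^ m * Real.exp (-x) * lowerGamma n x) -
      x ^ (m + 1) * Real.exp (-x) * lowerGamma n x + x ^ (m + n + 1) * Real.exp (-(2 * x)))
    (fun x _ => by
      have := ((hasDerivAt_pow (m + 1) x).mul ((hasDerivAt_neg x).exp)).mul
        (hasDerivAt_lowerGamma n x)
      refine this.congr_deriv ?_
      rw [two_mul, neg_add, Real.exp_add]
      simp only [Pi.mul_apply, Nat.add_sub_cancel]
      push_cast
      ring) hint hlim
  have hsub : Integrable (fun x : ℝ => (m + 1) * (x ^ m * Real.exp (-x) * lowerGamma n x) -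
      x ^ (m + 1) * Real.exp (-x) * lowerGamma n x) (volume.restrict (Ioi 0)) :=
    ((integrableOn_phi m n).const_mul (m + 1 : ℝ)).sub (integrableOn_phi (m + 1) n)
  rw [integral_add hsub
    (integrableOn_pow_mul_exp (m + n + 1) two_pos),
    integral_sub ((integrableOn_phi m n).const_mul (m + 1 : ℝ)) (integrableOn_phi (m + 1) n),
    integral_const_mul, ← phiIntegral_eq, ← phiIntegral_eq,
    integral_pow_mul_exp (m + n + 1) two_pos] at h
  simp only [ne_eq, Nat.add_eq_zero_iff, one_ne_zero, and_false, not_false_eq_true, zero_pow,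
    zero_mul, sub_zero] at h
  linarith

lemma phiIntegral_zero_zero : phiIntegral 0 0 = 1 / 2 := by
  have h1 := integral_pow_mul_exp 0 one_pos
  have h2 := integral_pow_mul_exp 0 two_pos
  have i1 := integrableOn_pow_mul_exp 0 one_pos
  have i2 := integrableOn_pow_mul_exp 0 two_pos
  have hl : ∀ x, lowerGamma 0 x = 1 - Real.exp (-x) := by
    intro x
    simp [lowerGamma, intervalIntegral.integral_comp_neg (fun y => Real.exp y)]
  have : ∀ x ∈ Ioi (0 : ℝ), x ^ 0 * Real.exp (-x) * lowerGamma 0 x =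
      x ^ 0 * Real.exp (-(1 * x)) - x ^ 0 * Real.exp (-(2 * x)) := by
    intro x _
    rw [hl, two_mul, neg_add, Real.exp_add]
    ring_nf
  rw [phiIntegral_eq, setIntegral_congr_fun measurableSet_Ioi this, integral_sub i1 i2, h1, h2]
  norm_num

lemma isPhi_phiIntegral : IsPhi phiIntegral := by
  have h00 := phiIntegral_zero_zero
  have h10 := phiIntegral_succ_left 0 0
  have h20 := phiIntegral_succ_left 1 0
  have h30 := phiIntegral_succ_left 2 0
  have h21 := phiIntegral_succ_right 2 0
  have h11 := phiIntegral_succ_right 1 0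
  have h12 := phiIntegral_succ_right 1 1
  have h01 := phiIntegral_succ_right 0 0
  have h02 := phiIntegral_succ_right 0 1
  have h03 := phiIntegral_succ_right 0 2
  norm_num [Nat.factorial] at h00 h10 h20 h30 h21 h11 h12 h01 h02 h03
  refine ⟨fun m n hm hn => ?_, by linarith, by linarith, by linarith, by linarith⟩
  obtain ⟨m, rfl⟩ := Nat.exists_eq_add_of_le' hm
  obtain ⟨n, rfl⟩ := Nat.exists_eq_add_of_le' hn
  rw [phiIntegral_succ_right, phiIntegral_succ_left]
  simp only [Nat.add_sub_cancel]
  rw [show m + 1 + (n + 1) - 1 = m + n + 1 by omega, show m + 1 + n + 1 = (m + n + 1) + 1 by omega,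
    Nat.factorial_succ (m + n + 1), show m + 1 + n + 2 = m + n + 2 + 1 by omega,
    show m + 1 + (n + 1) + 1 = m + n + 2 + 1 by omega, pow_succ (2 : ℝ) (m + n + 2)]
  push_cast
  field_simp
  ring

/-- The recursion and its initial values determine `φ m n` on the diagonals `m - n = ±1, ±3`,
from the line `m + n = 3` on. -/
lemma IsPhi.eq_on {φ ψ : ℕ → ℕ → ℝ} (hφ : IsPhi φ) (hψ : IsPhi ψ) (m : ℕ) :
    φ (m + 3) m = ψ (m + 3) m ∧ φ (m + 2) (m + 1) = ψ (m + 2) (m + 1) ∧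
      φ (m + 1) (m + 2) = ψ (m + 1) (m + 2) ∧ φ m (m + 3) = ψ m (m + 3) := by
  have hstep : ∀ a b, φ a b = ψ a b → φ (a + 1) (b + 1) = ψ (a + 1) (b + 1) := by
    intro a b hab
    rw [hφ.recursion _ _ (by omega) (by omega), hψ.recursion _ _ (by omega) (by omega)]
    simp only [Nat.add_sub_cancel]
    rw [hab]
  induction m with
  | zero =>
    exact ⟨hφ.init_three_zero.trans hψ.init_three_zero.symm,
      hφ.init_two_one.trans hψ.init_two_one.symm, hφ.init_one_two.trans hψ.init_one_two.symm,
      hφ.init_zero_three.trans hψ.init_zero_three.symm⟩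
  | succ m ih =>
    exact ⟨hstep _ _ ih.1, hstep _ _ ih.2.1, hstep _ _ ih.2.2.1, hstep _ _ ih.2.2.2⟩

/-- Integrating a polynomial against `e^{-L-l}` over the sector `0 < l < L` yields a combination
of the values of `phiIntegral`. -/
lemma lintegral_polynomial_exp {ι : Type*} (s : Finset ι) (c : ι → ℝ) (p q : ι → ℕ)
    (hpos : ∀ L l : ℝ, 0 < l → l < L → 0 ≤ ∑ i ∈ s, c i * (L ^ p i * l ^ q i)) :
    0 ≤ ∑ i ∈ s, c i * phiIntegral (p i) (q i) ∧
    ∫⁻ L in Ioi (0 : ℝ), ∫⁻ l in Ioo 0 L,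
      ENNReal.ofReal ((∑ i ∈ s, c i * (L ^ p i * l ^ q i)) * Real.exp (-L - l)) =
      ENNReal.ofReal (∑ i ∈ s, c i * phiIntegral (p i) (q i)) := by
  have hval : ∀ L : ℝ, ∫ l in (0 : ℝ)..L,
      (∑ i ∈ s, c i * (L ^ p i * l ^ q i)) * Real.exp (-L - l) =
      ∑ i ∈ s, c i * (L ^ p i * Real.exp (-L) * lowerGamma (q i) L) := by
    intro L
    simp_rw [Finset.sum_mul]
    rw [intervalIntegral.integral_finsetSum
      (fun i _ => Continuous.intervalIntegrable (by fun_prop) _ _)]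
    refine Finset.sum_congr rfl fun i _ => ?_
    rw [lowerGamma, ← intervalIntegral.integral_const_mul, ← intervalIntegral.integral_const_mul]
    refine intervalIntegral.integral_congr fun l _ => ?_
    rw [sub_eq_add_neg, Real.exp_add]
    ring
  have hnn : ∀ L : ℝ, 0 < L → 0 ≤ᵐ[volume.restrict (Ioo 0 L)] fun l =>
      (∑ i ∈ s, c i * (L ^ p i * l ^ q i)) * Real.exp (-L - l) := by
    intro L _
    refine (ae_restrict_iff' measurableSet_Ioo).2 (ae_of_all _ fun l hl => ?_)
    exact mul_nonneg (hpos L l hl.1 hl.2) (Real.exp_pos _).le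
  have hinner : ∀ L ∈ Ioi (0 : ℝ), ∫⁻ l in Ioo 0 L,
      ENNReal.ofReal ((∑ i ∈ s, c i * (L ^ p i * l ^ q i)) * Real.exp (-L - l)) =
      ENNReal.ofReal (∑ i ∈ s, c i * (L ^ p i * Real.exp (-L) * lowerGamma (q i) L)) := by
    intro L hL
    have hL0 : (0 : ℝ) < L := hL
    rw [← ofReal_integral_eq_lintegral_ofReal ?_ (hnn L hL0), ← hval,
      intervalIntegral.integral_of_le hL0.le, restrict_Ioo_eq_restrict_Ioc]
    rw [restrict_Ioo_eq_restrict_Ioc]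
    exact Continuous.integrableOn_Ioc (by fun_prop)
  have houter : ∫ L in Ioi (0 : ℝ), ∑ i ∈ s, c i * (L ^ p i * Real.exp (-L) * lowerGamma (q i) L) =
      ∑ i ∈ s, c i * phiIntegral (p i) (q i) := by
    rw [integral_finsetSum _ fun i _ => (integrableOn_phi (p i) (q i)).const_mul (c i)]
    refine Finset.sum_congr rfl fun i _ => ?_
    rw [integral_const_mul, phiIntegral_eq]
  have hnn' : 0 ≤ᵐ[volume.restrict (Ioi 0)] fun L : ℝ =>
      ∑ i ∈ s, c i * (L ^ p i * Real.exp (-L) * lowerGamma (q i) L) := by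
    refine (ae_restrict_iff' measurableSet_Ioi).2 (ae_of_all _ fun L (hL : 0 < L) => ?_)
    simp only [Pi.zero_apply]
    rw [← hval, intervalIntegral.integral_of_le hL.le, ← restrict_Ioo_eq_restrict_Ioc]
    exact integral_nonneg_of_ae (hnn L hL)
  refine ⟨houter ▸ integral_nonneg_of_ae hnn', ?_⟩
  rw [setLIntegral_congr_fun measurableSet_Ioi hinner,
    ← ofReal_integral_eq_lintegral_ofReal ?_ hnn', houter]
  exact integrable_finsetSum _ fun i _ => (integrableOn_phi (p i) (q i)).const_mul (c i)

/-- The closed form of the mean received power of the first block, for a codebook of size `n` and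
`m + 2` receive antennas. The shift by `2` avoids truncated subtraction. -/
noncomputable def meanPower (m n : ℕ) : ℝ :=
  1 / ((m + 1).factorial * m.factorial) *
    (phiIntegral (m + 3) m - 2 * phiIntegral (m + 2) (m + 1) + phiIntegral (m + 1) (m + 2)
      - 1 / (n + 1) * (phiIntegral (m + 3) m - 3 * phiIntegral (m + 2) (m + 1)
        + 3 * phiIntegral (m + 1) (m + 2) - phiIntegral m (m + 3)))

/-- The conditional mean `l + (L - l) n / (n + 1)` of the best received power over a codebook of
size `n`, averaged over the Rayleigh matrix `H`. -/
lemma lintegral_rayleighLaw_beamforming (m n : ℕ) :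
    0 ≤ meanPower m n ∧ ∫⁻ H, ENNReal.ofReal
      (eigMin (nsq (Hᵀ 0)) (Complex.normSq (star (Hᵀ 0) ⬝ᵥ Hᵀ 1)) (nsq (Hᵀ 1)) +
        gap (nsq (Hᵀ 0)) (Complex.normSq (star (Hᵀ 0) ⬝ᵥ Hᵀ 1)) (nsq (Hᵀ 1)) * (n / (n + 1)))
        ∂rayleighLaw (m + 2) 2 =
    ENNReal.ofReal (meanPower m n) := by
  have h := lintegral_rayleighLaw_eig m
    (g := fun z => ENNReal.ofReal (z.2 + (z.1 - z.2) * (n / (n + 1)))) (by fun_prop)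
  have hgap : ∀ a b d : ℝ, eigMax a b d - eigMin a b d = gap a b d := by
    intro a b d; rw [eigMax, eigMin]; ring
  simp only [hgap] at h
  rw [h, meanPower]
  set C : ℝ := 1 / ((m + 1).factorial * m.factorial) with hC
  have hC0 : 0 ≤ C := by positivity
  have hn : (n : ℝ) + 1 ≠ 0 := by positivity
  have hsum : ∀ L l : ℝ, ∑ i : Fin 4, (![C * (1 - 1 / (n + 1)), C * (-2 + 3 / (n + 1)),
      C * (1 - 3 / (n + 1)), C / (n + 1)] : Fin 4 → ℝ) i *
      (L ^ (![m + 3, m + 2, m + 1, m] : Fin 4 → ℕ) i * l ^ (![m, m + 1, m + 2, m + 3] : Fin 4 → ℕ) i) =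
      (L * l) ^ m * (L - l) ^ 2 * C * (l + (L - l) * (n / (n + 1))) := by
    intro L l
    simp only [Fin.sum_univ_four, Matrix.cons_val]
    field_simp
    ring
  have hP := lintegral_polynomial_exp Finset.univ
    (![C * (1 - 1 / (n + 1)), C * (-2 + 3 / (n + 1)), C * (1 - 3 / (n + 1)), C / (n + 1)])
    (![m + 3, m + 2, m + 1, m] : Fin 4 → ℕ) (![m, m + 1, m + 2, m + 3]) (by
      intro L l hl hL
      rw [hsum]
      have h1 : 0 ≤ L - l := by linarith
      have h2 : 0 ≤ L := by linarith
      positivity)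
  simp only [Fin.sum_univ_four, Matrix.cons_val] at hP
  simp only [Fin.sum_univ_four, Matrix.cons_val] at hsum
  rw [show C * (phiIntegral (m + 3) m - 2 * phiIntegral (m + 2) (m + 1) +
      phiIntegral (m + 1) (m + 2) - 1 / (n + 1) * (phiIntegral (m + 3) m -
      3 * phiIntegral (m + 2) (m + 1) + 3 * phiIntegral (m + 1) (m + 2) -
      phiIntegral m (m + 3))) = C * (1 - 1 / (n + 1)) * phiIntegral (m + 3) m +
      C * (-2 + 3 / (n + 1)) * phiIntegral (m + 2) (m + 1) +
      C * (1 - 3 / (n + 1)) * phiIntegral (m + 1) (m + 2) +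
      C / (n + 1) * phiIntegral m (m + 3) by ring]
  refine ⟨hP.1, ?_⟩
  rw [← hP.2]
  refine setLIntegral_congr_fun measurableSet_Ioi fun L hL => ?_
  refine setLIntegral_congr_fun measurableSet_Ioo fun l hl => ?_
  have h1 : 0 ≤ L - l := by linarith [hl.2]
  have h2 : 0 ≤ L := le_of_lt hL
  have h3 : 0 ≤ l := hl.1.le
  rw [hsum, ← ENNReal.ofReal_mul (by positivity)]
  congr 1
  rw [hC]
  ring

/-! ### The Gauss–Markov recursion -/

lemma measurable_entry {a b : ℕ} (i : Fin a) (j : Fin b) :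
    Measurable fun M : Matrix (Fin a) (Fin b) ℂ => M i j :=
  (measurable_pi_apply j).comp (measurable_pi_apply (X := fun _ : Fin a => Fin b → ℂ) i)

lemma measurable_matrix {X : Type*} [MeasurableSpace X] {a b : ℕ}
    {f : X → Matrix (Fin a) (Fin b) ℂ} (h : ∀ i j, Measurable fun x => f x i j) : Measurable f :=
  measurable_pi_lambda (X := fun _ : Fin a => Fin b → ℂ) f
    fun i => measurable_pi_lambda _ fun j => h i j

lemma measurable_smul_add_smul {a b : ℕ} (c d : ℂ) :
    Measurable fun p : Matrix (Fin a) (Fin b) ℂ × Matrix (Fin a) (Fin b) ℂ =>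
      c • p.1 + d • p.2 :=
  measurable_matrix fun i j => by
    have := measurable_entry i j
    simp only [Matrix.add_apply, Matrix.smul_apply]
    fun_prop

lemma measurable_mulVec_uncurry {a b : ℕ} :
    Measurable fun p : Matrix (Fin a) (Fin b) ℂ × (Fin b → ℂ) => p.1 *ᵥ p.2 := by
  refine measurable_pi_lambda _ fun i => ?_
  have := fun j => measurable_entry (a := a) (b := b) i j
  simp only [Matrix.mulVec, dotProduct]
  fun_prop

lemma measurable_rxPower {a b : ℕ} :
    Measurable fun p : Matrix (Fin a) (Fin b) ℂ × (Fin b → ℂ) => rxPower p.1 p.2 := by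
  simp_rw [rxPower_eq_nsq]
  exact measurable_nsq.comp measurable_mulVec_uncurry

instance instIsProbabilityMeasureRayleighLaw (Nr Nt : ℕ) :
    IsProbabilityMeasure (rayleighLaw Nr Nt) :=
  Measure.isProbabilityMeasure_map (measurable_id (α := Fin Nr → Fin Nt → ℂ)).aemeasurable

/-- The Rayleigh law is symmetric. -/
lemma measurePreserving_neg_rayleighLaw (Nr Nt : ℕ) :
    MeasurePreserving (fun M => -M) (rayleighLaw Nr Nt) (rayleighLaw Nr Nt) := by
  have hrow : MeasurePreserving (fun v : Fin Nt → ℂ => -v) (gaussVec Nt) (gaussVec Nt) := by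
    refine ⟨by fun_prop, ?_⟩
    have hU : (-1 : Matrix (Fin Nt) (Fin Nt) ℂ) ∈ Matrix.unitaryGroup (Fin Nt) ℂ := by
      rw [Matrix.mem_unitaryGroup_iff]; simp
    simpa [Matrix.neg_mulVec] using map_mulVec_gaussVec hU
  have h := measurePreserving_pi (fun _ : Fin Nr => gaussVec Nt) (fun _ => gaussVec Nt)
    (fun _ => hrow)
  have hid : rayleighLaw Nr Nt = Measure.pi fun _ : Fin Nr => gaussVec Nt := Measure.map_id
  rw [hid]
  exact h

lemma lintegral_normSq_coord : ∫⁻ r : Fin 2 → ℂ, ENNReal.ofReal (Complex.normSq (r 0)) ∂gaussVec 2 =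
    1 := by
  have hmn := Complex.continuous_normSq.measurable
  have h := measurePreserving_eval (fun _ : Fin 2 => stdComplexGaussian) 0
  have h1 := h.lintegral_comp (f := fun z => ENNReal.ofReal (Complex.normSq z)) (by fun_prop)
  have h2 := lintegral_nsq_gaussVec 1 (f := fun _ => 1) measurable_const
  simp only [lintegral_const, measure_univ, mul_one, pow_one, Nat.factorial_one, Nat.cast_one,
    div_one] at h2
  rw [lintegral_normSq_stdComplexGaussian (f := fun x => ENNReal.ofReal x) (by fun_prop), ← h2] at h1
  exact h1

/-- A Rayleigh matrix with `Nr` rows amplifies a fixed unit vector to the mean power `Nr`. -/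
lemma lintegral_nsq_rayleighLaw {Nr : ℕ} {v : Fin 2 → ℂ} (hv : nsq v = 1) :
    ∫⁻ M, ENNReal.ofReal (nsq (M *ᵥ v)) ∂rayleighLaw Nr 2 = Nr := by
  have hmn := Complex.continuous_normSq.measurable
  have hid : rayleighLaw Nr 2 = Measure.pi fun _ : Fin Nr => gaussVec 2 := Measure.map_id
  have hrow : ∫⁻ r : Fin 2 → ℂ, ENNReal.ofReal (Complex.normSq (r ⬝ᵥ v)) ∂gaussVec 2 = 1 := by
    obtain ⟨U, hU, hrow⟩ := exists_unitary_normSq_mulVec_zero (star v)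
    have hsv : nsq (star v) = 1 := by
      rw [← hv]; simp [nsq]
    rw [← lintegral_normSq_coord]
    conv_rhs => rw [← map_mulVec_gaussVec hU]
    rw [lintegral_map (by fun_prop) (measurable_mulVec U)]
    refine lintegral_congr fun r => ?_
    have := hrow r
    rw [hsv, mul_one, star_star] at this
    rw [this, dotProduct_comm]
  have hm : Measurable fun r : Fin 2 → ℂ => ENNReal.ofReal (Complex.normSq (r ⬝ᵥ v)) := by
    simp only [dotProduct]
    fun_prop
  have hentry : ∀ i, ∫⁻ M : Fin Nr → Fin 2 → ℂ, ENNReal.ofReal (Complex.normSq (M i ⬝ᵥ v))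
      ∂(Measure.pi fun _ : Fin Nr => gaussVec 2) = 1 := fun i =>
    ((measurePreserving_eval (fun _ : Fin Nr => gaussVec 2) i).lintegral_comp hm).trans hrow
  have hsum : ∀ M : Fin Nr → Fin 2 → ℂ, ENNReal.ofReal (nsq (Matrix.mulVec M v)) =
      ∑ i, ENNReal.ofReal (Complex.normSq (M i ⬝ᵥ v)) := fun M =>
    ENNReal.ofReal_sum_of_nonneg fun i _ => Complex.normSq_nonneg _
  have htotal : ∫⁻ M : Fin Nr → Fin 2 → ℂ, ∑ i, ENNReal.ofReal (Complex.normSq (M i ⬝ᵥ v))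
      ∂(Measure.pi fun _ : Fin Nr => gaussVec 2) = Nr := by
    rw [lintegral_finsetSum (f := fun i (M : Fin Nr → Fin 2 → ℂ) =>
      ENNReal.ofReal (Complex.normSq (M i ⬝ᵥ v))) _ fun i _ => hm.comp (measurable_pi_apply i)]
    rw [Finset.sum_congr rfl fun i _ => hentry i]
    simp
  rw [hid]
  exact (lintegral_congr hsum).trans htotal

lemma nsq_add_add_nsq_sub {m : ℕ} (a b : ℝ) (x y : Fin m → ℂ) :
    nsq ((a : ℂ) • x + (b : ℂ) • y) + nsq ((a : ℂ) • x - (b : ℂ) • y) =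
      2 * (a ^ 2 * nsq x + b ^ 2 * nsq y) := by
  simp only [nsq, Finset.mul_sum, ← Finset.sum_add_distrib]
  refine Finset.sum_congr rfl fun i _ => ?_
  simp [Complex.normSq_apply]
  ring

/-- The parallelogram identity together with the symmetry of the Rayleigh law removes the cross
term between the scaled old channel and the innovation. -/
lemma lintegral_nsq_innovation {Nr : ℕ} (a b : ℝ) (M : Matrix (Fin Nr) (Fin 2) ℂ)
    {v : Fin 2 → ℂ} (hv : nsq v = 1) :
    ∫⁻ W, ENNReal.ofReal (nsq (((a : ℂ) • M + (b : ℂ) • W) *ᵥ v)) ∂rayleighLaw Nr 2 =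
      ENNReal.ofReal (a ^ 2 * nsq (M *ᵥ v) + b ^ 2 * Nr) := by
  have hmM : Measurable fun W : Matrix (Fin Nr) (Fin 2) ℂ => W *ᵥ v := by
    have h := measurable_mulVec_uncurry.comp
      ((measurable_id (α := Matrix (Fin Nr) (Fin 2) ℂ)).prodMk (measurable_const (a := v)))
    exact h
  have hmq : Measurable (nsq : (Fin Nr → ℂ) → ℝ) := measurable_nsq
  have hcalc : ∀ W : Matrix (Fin Nr) (Fin 2) ℂ, ((a : ℂ) • M + (b : ℂ) • W) *ᵥ v =
      (a : ℂ) • (M *ᵥ v) + (b : ℂ) • (W *ᵥ v) := by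
    intro W
    rw [Matrix.add_mulVec, Matrix.smul_mulVec, Matrix.smul_mulVec]
  have hcalc' : ∀ W : Matrix (Fin Nr) (Fin 2) ℂ, ((a : ℂ) • M + (b : ℂ) • (-W)) *ᵥ v =
      (a : ℂ) • (M *ᵥ v) - (b : ℂ) • (W *ᵥ v) := by
    intro W
    rw [hcalc, Matrix.neg_mulVec, smul_neg, sub_eq_add_neg]
  have hmf : Measurable fun W : Matrix (Fin Nr) (Fin 2) ℂ =>
      ENNReal.ofReal (nsq (((a : ℂ) • M + (b : ℂ) • W) *ᵥ v)) := by
    simp_rw [hcalc]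
    fun_prop
  set I := ∫⁻ W, ENNReal.ofReal (nsq (((a : ℂ) • M + (b : ℂ) • W) *ᵥ v)) ∂rayleighLaw Nr 2 with hI
  have hneg : ∫⁻ W, ENNReal.ofReal (nsq (((a : ℂ) • M + (b : ℂ) • (-W)) *ᵥ v)) ∂rayleighLaw Nr 2 =
      I := (measurePreserving_neg_rayleighLaw Nr 2).lintegral_comp hmf
  have hdouble : I + I = 2 * ENNReal.ofReal (a ^ 2 * nsq (M *ᵥ v) + b ^ 2 * Nr) := by
    nth_rewrite 2 [← hneg]
    rw [hI, ← lintegral_add_left hmf]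
    have h1 : ∀ W : Matrix (Fin Nr) (Fin 2) ℂ,
        ENNReal.ofReal (nsq (((a : ℂ) • M + (b : ℂ) • W) *ᵥ v)) +
          ENNReal.ofReal (nsq (((a : ℂ) • M + (b : ℂ) • (-W)) *ᵥ v)) =
        2 * (ENNReal.ofReal (a ^ 2 * nsq (M *ᵥ v)) +
          ENNReal.ofReal (b ^ 2) * ENNReal.ofReal (nsq (W *ᵥ v))) := by
      intro W
      have h0 := nsq_nonneg (M *ᵥ v)
      have h0' := nsq_nonneg (W *ᵥ v)
      rw [← ENNReal.ofReal_add (nsq_nonneg _) (nsq_nonneg _), hcalc, hcalc', nsq_add_add_nsq_sub,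
        ENNReal.ofReal_mul two_pos.le, ENNReal.ofReal_add (by positivity) (by positivity),
        ENNReal.ofReal_mul (p := b ^ 2) (by positivity)]
      simp
    have h0 := nsq_nonneg (M *ᵥ v)
    simp_rw [h1]
    rw [lintegral_const_mul' _ _ (by simp), lintegral_add_left measurable_const,
      lintegral_const_mul' _ _ ENNReal.ofReal_ne_top, lintegral_nsq_rayleighLaw hv,
      ENNReal.ofReal_add (by positivity) (by positivity),
      ENNReal.ofReal_mul (p := b ^ 2) (by positivity)]
    simp
  rw [← two_mul] at hdouble
  exact (ENNReal.mul_right_inj (by simp) (by simp)).1 hdouble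

/-- If `f`, `g` are independent and the pair `(f, g)` is independent of `h`, then `f` is
independent of the pair `(g, h)`. -/
lemma indepFun_prodMk_of_prodMk {Ω A B C : Type*} [MeasurableSpace Ω] [MeasurableSpace A]
    [MeasurableSpace B] [MeasurableSpace C] {P : Measure Ω} [IsProbabilityMeasure P]
    {f : Ω → A} {g : Ω → B} {h : Ω → C} (hf : Measurable f) (hg : Measurable g) (hh : Measurable h)
    (h1 : IndepFun f g P) (h2 : IndepFun (fun ω => (f ω, g ω)) h P) :
    IndepFun f (fun ω => (g ω, h ω)) P := by
  have h3 : IndepFun g h P := h2.comp measurable_snd measurable_id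
  rw [indepFun_iff_map_prod_eq_prod_map_map hf.aemeasurable hg.aemeasurable] at h1
  rw [indepFun_iff_map_prod_eq_prod_map_map (hf.prodMk hg).aemeasurable hh.aemeasurable] at h2
  rw [indepFun_iff_map_prod_eq_prod_map_map hg.aemeasurable hh.aemeasurable] at h3
  rw [indepFun_iff_map_prod_eq_prod_map_map hf.aemeasurable (hg.prodMk hh).aemeasurable]
  have hpf : IsProbabilityMeasure (P.map f) := Measure.isProbabilityMeasure_map hf.aemeasurable
  have hpg : IsProbabilityMeasure (P.map g) := Measure.isProbabilityMeasure_map hg.aemeasurable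
  have hph : IsProbabilityMeasure (P.map h) := Measure.isProbabilityMeasure_map hh.aemeasurable
  rw [h3, ← Measure.prodAssoc_prod, ← h1, ← h2,
    Measure.map_map MeasurableEquiv.prodAssoc.measurable ((hf.prodMk hg).prodMk hh)]
  rfl

section Model

variable {Ω : Type*} [MeasurableSpace Ω] {P : Measure Ω} {Nr n : ℕ}
  {α : ℝ} {H : ℕ → Ω → Matrix (Fin Nr) (Fin 2) ℂ} {W : Ici (2 : ℕ) → Ω → Matrix (Fin Nr) (Fin 2) ℂ}
  {V : Fin n → Ω → Fin 2 → ℂ}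
  {sel : Matrix (Fin Nr) (Fin 2) ℂ → (Fin n → Fin 2 → ℂ) → Fin n}

/-- The block index `k + 1 ≥ 2` of the innovation that leads from block `k ≥ 1` to block
`k + 1`. -/
def nextBlock (k : ℕ) (hk : 1 ≤ k) : Ici (2 : ℕ) := ⟨k + 1, Nat.succ_le_succ hk⟩

lemma channel_succ (hmodel : IsGaussMarkovRVQ P α H W V) {k : ℕ} (hk : 1 ≤ k) (ω : Ω) :
    H (k + 1) ω = (α : ℂ) • H k ω + (Real.sqrt (1 - α ^ 2) : ℂ) • W (nextBlock k hk) ω :=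
  hmodel.step (nextBlock k hk) ω

/-- The innovations up to block `m`. -/
def pastBlocks (m : ℕ) : Finset (Ici (2 : ℕ)) := (Finset.Icc 2 m).subtype (· ∈ Ici (2 : ℕ))

/-- The channel of block `k` is a measurable function of the initial channel and of the
innovations up to any block `m ≥ k`. -/
lemma exists_channel_eq (hmodel : IsGaussMarkovRVQ P α H W V) (m : ℕ) {k : ℕ} (hk : 1 ≤ k)
    (hkm : k ≤ m) :
    ∃ F : Matrix (Fin Nr) (Fin 2) ℂ × (pastBlocks m → Matrix (Fin Nr) (Fin 2) ℂ) →
      Matrix (Fin Nr) (Fin 2) ℂ, Measurable F ∧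
      ∀ ω, H k ω = F (H 1 ω, fun i => W i ω) := by
  induction k, hk using Nat.le_induction with
  | base => exact ⟨Prod.fst, measurable_fst, fun _ => rfl⟩
  | succ k hk ih =>
    obtain ⟨F, hF, hFH⟩ := ih (by omega)
    have hmem : nextBlock k hk ∈ pastBlocks m := by
      rw [pastBlocks, Finset.mem_subtype, Finset.mem_Icc]
      exact ⟨Nat.succ_le_succ hk, hkm⟩
    refine ⟨fun p => (α : ℂ) • F p + (Real.sqrt (1 - α ^ 2) : ℂ) • p.2 ⟨nextBlock k hk, hmem⟩,
      ?_, fun ω => ?_⟩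
    · exact (measurable_smul_add_smul _ _).comp
        (hF.prodMk ((measurable_pi_apply _).comp measurable_snd))
    · rw [channel_succ hmodel hk, hFH]

lemma measurable_channel (hmodel : IsGaussMarkovRVQ P α H W V) {k : ℕ} (hk : 1 ≤ k) :
    Measurable (H k) := by
  obtain ⟨F, hF, hFH⟩ := exists_channel_eq hmodel k hk le_rfl
  rw [funext hFH]
  exact hF.comp (hmodel.measurable_init.prodMk
    (measurable_pi_lambda _ fun i => hmodel.measurable_innov i))

lemma measurable_select (hsel : IsArgmaxRule sel) :
    Measurable fun p : Matrix (Fin Nr) (Fin 2) ℂ × (Fin n → Fin 2 → ℂ) => p.2 (sel p.1 p.2) := by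
  have h : Measurable fun q : (Fin n → Fin 2 → ℂ) × Fin n => q.1 q.2 :=
    measurable_from_prod_countable_left fun j => measurable_pi_apply j
  exact h.comp (measurable_snd.prodMk hsel.measurable)

lemma measurable_code (hmodel : IsGaussMarkovRVQ P α H W V) :
    Measurable fun ω j => V j ω :=
  measurable_pi_lambda _ hmodel.measurable_code

lemma measurable_quantizedBeamformer (hmodel : IsGaussMarkovRVQ P α H W V)
    (hsel : IsArgmaxRule sel) : Measurable (quantizedBeamformer sel H V) :=
  (measurable_select hsel).comp (hmodel.measurable_init.prodMk (measurable_code hmodel))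

lemma measurable_rxPower_channel (hmodel : IsGaussMarkovRVQ P α H W V) (hsel : IsArgmaxRule sel)
    {k : ℕ} (hk : 1 ≤ k) :
    Measurable fun ω => rxPower (H k ω) (quantizedBeamformer sel H V ω) := by
  have hpair := (measurable_channel hmodel hk).prodMk (measurable_quantizedBeamformer hmodel hsel)
  have h := measurable_rxPower.comp hpair
  exact h

lemma ae_nsq_quantizedBeamformer (hmodel : IsGaussMarkovRVQ P α H W V) :
    ∀ᵐ ω ∂P, nsq (quantizedBeamformer sel H V ω) = 1 := by
  have : ∀ᵐ ω ∂P, ∀ j, star (V j ω) ⬝ᵥ V j ω = 1 :=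
    ae_all_iff.2 fun j => ae_of_ae_map (hmodel.measurable_code j).aemeasurable
      (hmodel.law_code j).unit_norm
  filter_upwards [this] with ω hω
  rw [nsq_eq_re, quantizedBeamformer, hω, Complex.one_re]

/-- The innovation of the next block is independent of the present channel and the beamformer. -/
lemma indepFun_innovation [IsProbabilityMeasure P] (hmodel : IsGaussMarkovRVQ P α H W V) (hsel : IsArgmaxRule sel)
    {k : ℕ} (hk : 1 ≤ k) :
    IndepFun (W (nextBlock k hk)) (fun ω => (H k ω, quantizedBeamformer sel H V ω)) P := by
  have hmpast : Measurable fun ω (i : pastBlocks k) => W i ω :=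
    measurable_pi_lambda _ fun i => hmodel.measurable_innov i
  have hmV := measurable_code hmodel
  have hmnext := hmodel.measurable_innov (nextBlock k hk)
  have hdisj : Disjoint {nextBlock k hk} (pastBlocks k) := by
    rw [Finset.disjoint_singleton_left, pastBlocks, Finset.mem_subtype, Finset.mem_Icc]
    rintro ⟨-, h⟩
    exact absurd h (Nat.not_succ_le_self k)
  have heval : Measurable fun w : ({nextBlock k hk} : Finset (Ici (2 : ℕ))) →
      Matrix (Fin Nr) (Fin 2) ℂ => w ⟨nextBlock k hk, Finset.mem_singleton_self _⟩ :=
    measurable_pi_apply _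
  have h1 : IndepFun (W (nextBlock k hk)) (fun ω (i : pastBlocks k) => W i ω) P :=
    (hmodel.indep_innov.indepFun_finset _ _ hdisj hmodel.measurable_innov).comp heval
      measurable_id
  have hres : Measurable fun w : Ici (2 : ℕ) → Matrix (Fin Nr) (Fin 2) ℂ =>
      (w (nextBlock k hk), fun i : pastBlocks k => w i) := by fun_prop
  have h2 : IndepFun (fun ω => (W (nextBlock k hk) ω, fun i : pastBlocks k => W i ω))
      (fun ω j => V j ω) P := hmodel.indep_innov_code.comp hres measurable_id
  have h3 := indepFun_prodMk_of_prodMk hmnext hmpast hmV h1 h2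
  have hres' : Measurable fun q : (Ici (2 : ℕ) → Matrix (Fin Nr) (Fin 2) ℂ) ×
      (Fin n → Fin 2 → ℂ) => (q.1 (nextBlock k hk), (fun i : pastBlocks k => q.1 i), q.2) := by
    fun_prop
  have h4 : IndepFun (fun ω => (W (nextBlock k hk) ω, (fun i : pastBlocks k => W i ω),
      fun j => V j ω)) (H 1) P := (hmodel.indep_init.comp measurable_id hres').symm
  have h5 := indepFun_prodMk_of_prodMk hmnext (hmpast.prodMk hmV) hmodel.measurable_init h3 h4
  obtain ⟨F, hF, hFH⟩ := exists_channel_eq hmodel k hk le_rfl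
  have hG : Measurable fun q : ((pastBlocks k → Matrix (Fin Nr) (Fin 2) ℂ) ×
      (Fin n → Fin 2 → ℂ)) × Matrix (Fin Nr) (Fin 2) ℂ =>
      (F (q.2, q.1.1), q.1.2 (sel q.2 q.1.2)) :=
    (hF.comp (by fun_prop)).prodMk ((measurable_select hsel).comp
      (measurable_snd.prodMk (measurable_snd.comp measurable_fst)))
  have h6 := h5.comp measurable_id hG
  have heq : (fun ω => (H k ω, quantizedBeamformer sel H V ω)) =
      (fun q : ((pastBlocks k → Matrix (Fin Nr) (Fin 2) ℂ) × (Fin n → Fin 2 → ℂ)) ×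
        Matrix (Fin Nr) (Fin 2) ℂ => (F (q.2, q.1.1), q.1.2 (sel q.2 q.1.2))) ∘
      fun ω => (((fun i : pastBlocks k => W i ω), fun j => V j ω), H 1 ω) := by
    ext ω : 1
    rw [Function.comp_apply, ← hFH]
    rfl
  rw [heq]
  exact h6

/-- The recursion for the mean received power from block to block. -/
lemma lintegral_rxPower_succ [IsProbabilityMeasure P] (hmodel : IsGaussMarkovRVQ P α H W V) (hsel : IsArgmaxRule sel)
    (hα0 : 0 ≤ α) (hα1 : α < 1) {k : ℕ} (hk : 1 ≤ k) :
    ∫⁻ ω, ENNReal.ofReal (rxPower (H (k + 1) ω) (quantizedBeamformer sel H V ω)) ∂P =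
      ENNReal.ofReal (α ^ 2) *
        ∫⁻ ω, ENNReal.ofReal (rxPower (H k ω) (quantizedBeamformer sel H V ω)) ∂P +
      ENNReal.ofReal ((1 - α ^ 2) * Nr) := by
  have hα2 : 0 ≤ 1 - α ^ 2 := by nlinarith
  have hsq : Real.sqrt (1 - α ^ 2) ^ 2 = 1 - α ^ 2 := Real.sq_sqrt hα2
  have hmW := hmodel.measurable_innov (nextBlock k hk)
  have hmHv : Measurable fun ω => (H k ω, quantizedBeamformer sel H V ω) :=
    (measurable_channel hmodel hk).prodMk (measurable_quantizedBeamformer hmodel hsel)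
  have hprob : IsProbabilityMeasure (P.map fun ω => (H k ω, quantizedBeamformer sel H V ω)) :=
    Measure.isProbabilityMeasure_map hmHv.aemeasurable
  have hlaw := (indepFun_iff_map_prod_eq_prod_map_map hmW.aemeasurable hmHv.aemeasurable).1
    (indepFun_innovation hmodel hsel hk)
  rw [hmodel.law_innov] at hlaw
  have hmF : Measurable fun p : Matrix (Fin Nr) (Fin 2) ℂ × Matrix (Fin Nr) (Fin 2) ℂ ×
      (Fin 2 → ℂ) => ENNReal.ofReal (nsq
        (((α : ℂ) • p.2.1 + (Real.sqrt (1 - α ^ 2) : ℂ) • p.1) *ᵥ p.2.2)) := by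
    have hsum := (measurable_smul_add_smul (a := Nr) (b := 2) α (Real.sqrt (1 - α ^ 2))).comp
      ((measurable_fst.comp measurable_snd).prodMk measurable_fst :
        Measurable fun p : Matrix (Fin Nr) (Fin 2) ℂ × Matrix (Fin Nr) (Fin 2) ℂ ×
          (Fin 2 → ℂ) => (p.2.1, p.1))
    have hpair := hsum.prodMk (measurable_snd.comp (measurable_snd (α := Matrix (Fin Nr) (Fin 2) ℂ)
      (β := Matrix (Fin Nr) (Fin 2) ℂ × (Fin 2 → ℂ))))
    have h := ENNReal.measurable_ofReal.comp
      (measurable_nsq.comp (measurable_mulVec_uncurry.comp hpair))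
    exact h
  have h1 : ∫⁻ ω, ENNReal.ofReal (rxPower (H (k + 1) ω) (quantizedBeamformer sel H V ω)) ∂P =
      ∫⁻ p, ENNReal.ofReal (nsq
        (((α : ℂ) • p.2.1 + (Real.sqrt (1 - α ^ 2) : ℂ) • p.1) *ᵥ p.2.2))
        ∂(P.map fun ω => (W (nextBlock k hk) ω, H k ω, quantizedBeamformer sel H V ω)) := by
    rw [lintegral_map hmF (hmW.prodMk hmHv)]
    refine lintegral_congr fun ω => ?_
    rw [rxPower_eq_nsq, channel_succ hmodel hk]
  rw [h1, hlaw, lintegral_prod_symm _ hmF.aemeasurable]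
  have hmg : Measurable fun q : Matrix (Fin Nr) (Fin 2) ℂ × (Fin 2 → ℂ) => ∫⁻ M, ENNReal.ofReal
      (nsq (((α : ℂ) • q.1 + (Real.sqrt (1 - α ^ 2) : ℂ) • M) *ᵥ q.2)) ∂rayleighLaw Nr 2 :=
    hmF.lintegral_prod_left'
  rw [lintegral_map hmg hmHv]
  have hae : ∀ᵐ ω ∂P, ∫⁻ M, ENNReal.ofReal (nsq (((α : ℂ) • H k ω +
      (Real.sqrt (1 - α ^ 2) : ℂ) • M) *ᵥ quantizedBeamformer sel H V ω)) ∂rayleighLaw Nr 2 =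
      ENNReal.ofReal (α ^ 2) *
        ENNReal.ofReal (rxPower (H k ω) (quantizedBeamformer sel H V ω)) +
      ENNReal.ofReal ((1 - α ^ 2) * Nr) := by
    filter_upwards [ae_nsq_quantizedBeamformer (sel := sel) hmodel] with ω hω
    have h0 := nsq_nonneg (H k ω *ᵥ quantizedBeamformer sel H V ω)
    rw [lintegral_nsq_innovation _ _ _ hω, hsq, rxPower_eq_nsq,
      ENNReal.ofReal_add (by positivity) (by positivity), ENNReal.ofReal_mul (by positivity)]
  rw [lintegral_congr_ae hae, lintegral_add_right _ measurable_const,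
    lintegral_const_mul' _ _ ENNReal.ofReal_ne_top]
  simp

/-- The mean received power of the first block. -/
lemma lintegral_rxPower_init [IsProbabilityMeasure P] {m : ℕ} {H : ℕ → Ω → Matrix (Fin (m + 2)) (Fin 2) ℂ}
    {W : Ici (2 : ℕ) → Ω → Matrix (Fin (m + 2)) (Fin 2) ℂ}
    {sel : Matrix (Fin (m + 2)) (Fin 2) ℂ → (Fin n → Fin 2 → ℂ) → Fin n}
    (hmodel : IsGaussMarkovRVQ P α H W V) (hsel : IsArgmaxRule sel) :
    ∫⁻ ω, ENNReal.ofReal (rxPower (H 1 ω) (quantizedBeamformer sel H V ω)) ∂P =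
      ENNReal.ofReal (meanPower m n) := by
  have hmV := measurable_code hmodel
  have hmH := hmodel.measurable_init
  have hind : IndepFun (H 1) (fun ω j => V j ω) P :=
    hmodel.indep_init.comp measurable_id measurable_snd
  have hlaw := (indepFun_iff_map_prod_eq_prod_map_map hmH.aemeasurable hmV.aemeasurable).1 hind
  rw [hmodel.law_init, (iIndepFun_iff_map_fun_eq_pi_map
    fun j => (hmodel.measurable_code j).aemeasurable).1 hmodel.indep_code] at hlaw
  have hp : ∀ j, IsProbabilityMeasure (P.map (V j)) :=
    fun j => (hmodel.law_code j).isProbabilityMeasure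
  have hmF : Measurable fun p : Matrix (Fin (m + 2)) (Fin 2) ℂ × (Fin n → Fin 2 → ℂ) =>
      ENNReal.ofReal (rxPower p.1 (p.2 (sel p.1 p.2))) := by
    have h := ENNReal.measurable_ofReal.comp
      (measurable_rxPower.comp (measurable_fst.prodMk (measurable_select hsel)))
    exact h
  have h1 : ∫⁻ ω, ENNReal.ofReal (rxPower (H 1 ω) (quantizedBeamformer sel H V ω)) ∂P =
      ∫⁻ p, ENNReal.ofReal (rxPower p.1 (p.2 (sel p.1 p.2)))
        ∂(P.map fun ω => (H 1 ω, fun j => V j ω)) := by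
    rw [lintegral_map hmF (hmH.prodMk hmV)]
    rfl
  rw [h1, hlaw, lintegral_prod _ hmF.aemeasurable,
    ← (lintegral_rayleighLaw_beamforming m n).2]
  exact lintegral_congr fun M => lintegral_rxPower_codebook hsel hmodel.law_code M rfl rfl rfl

end Model

end RVQ

open RVQ in
theorem lemma1 {Ω : Type*} [MeasurableSpace Ω] (P : Measure Ω) [IsProbabilityMeasure P]
    (Nr : ℕ) (hNr : 1 < Nr) (α : ℝ) (hα0 : 0 ≤ α) (hα1 : α < 1)
    (B : ℝ) (K n : ℕ) (hn : (n : ℝ) = (2 : ℝ) ^ (B * K))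
    (H : ℕ → Ω → Matrix (Fin Nr) (Fin 2) ℂ)
    (W : Ici (2 : ℕ) → Ω → Matrix (Fin Nr) (Fin 2) ℂ)
    (V : Fin n → Ω → Fin 2 → ℂ)
    (hmodel : IsGaussMarkovRVQ P α H W V)
    (sel : Matrix (Fin Nr) (Fin 2) ℂ → (Fin n → Fin 2 → ℂ) → Fin n)
    (hsel : IsArgmaxRule sel)
    (vhat : Ω → Fin 2 → ℂ) (hvhat : vhat = quantizedBeamformer sel H V)
    (γ : ℝ) (hγ : γ = ∫ ω, rxPower (H 1 ω) (vhat ω) ∂P) :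
    (∀ k : ℕ, 1 ≤ k →
      Integrable (fun ω => rxPower (H k ω) (vhat ω)) P ∧
      ∫ ω, rxPower (H k ω) (vhat ω) ∂P = α ^ (2 * k - 2) * (γ - Nr) + Nr) ∧
    IsPhi phiIntegral ∧
    (∀ φ : ℕ → ℕ → ℝ, IsPhi φ →
      γ = 1 / ((Nat.factorial (Nr - 1) : ℝ) * (Nat.factorial (Nr - 2) : ℝ)) *
        (φ (Nr + 1) (Nr - 2) - 2 * φ Nr (Nr - 1) + φ (Nr - 1) Nr
          - 1 / ((2 : ℝ) ^ (B * K) + 1) *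
            (φ (Nr + 1) (Nr - 2) - 3 * φ Nr (Nr - 1) + 3 * φ (Nr - 1) Nr
              - φ (Nr - 2) (Nr + 1)))) := by
  obtain ⟨m, rfl⟩ := Nat.exists_eq_add_of_le' hNr
  subst hvhat
  have hnn : ∀ k, 0 ≤ᵐ[P] fun ω => rxPower (H k ω) (quantizedBeamformer sel H V ω) :=
    fun k => ae_of_all _ fun ω => by
      simp only [Pi.zero_apply, rxPower_eq_nsq]
      exact nsq_nonneg _
  have hmean0 : 0 ≤ meanPower m n := (lintegral_rayleighLaw_beamforming m n).1
  have hinit : ∫⁻ ω, ENNReal.ofReal (rxPower (H 1 ω) (quantizedBeamformer sel H V ω)) ∂P =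
      ENNReal.ofReal (meanPower m n) := lintegral_rxPower_init hmodel hsel
  -- The nonnegativity of `x` matters, since `ENNReal.ofReal` sends negative numbers to `0`.
  have hintegral : ∀ {k : ℕ} {x : ℝ}, 1 ≤ k → 0 ≤ x →
      ∫⁻ ω, ENNReal.ofReal (rxPower (H k ω) (quantizedBeamformer sel H V ω)) ∂P =
        ENNReal.ofReal x →
      Integrable (fun ω => rxPower (H k ω) (quantizedBeamformer sel H V ω)) P ∧
        ∫ ω, rxPower (H k ω) (quantizedBeamformer sel H V ω) ∂P = x := by
    intro k x hk hx h
    have hmeas := (measurable_rxPower_channel hmodel hsel hk).aestronglyMeasurable (μ := P)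
    refine ⟨⟨hmeas, ?_⟩, ?_⟩
    · rw [hasFiniteIntegral_iff_ofReal (hnn k)]
      exact h ▸ ENNReal.ofReal_lt_top
    · rw [integral_eq_lintegral_of_nonneg_ae (hnn k) hmeas, h, ENNReal.toReal_ofReal hx]
  have hγm : γ = meanPower m n := hγ.trans (hintegral le_rfl hmean0 hinit).2
  have hα2 : 0 ≤ 1 - α ^ 2 := by nlinarith
  have hpow : ∀ j : ℕ, 0 ≤ α ^ (2 * j) * (γ - ((m + 2 : ℕ) : ℝ)) + ((m + 2 : ℕ) : ℝ) ∧
      ∫⁻ ω, ENNReal.ofReal (rxPower (H (j + 1) ω) (quantizedBeamformer sel H V ω)) ∂P =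
        ENNReal.ofReal (α ^ (2 * j) * (γ - ((m + 2 : ℕ) : ℝ)) + ((m + 2 : ℕ) : ℝ)) := by
    intro j
    induction j with
    | zero => simpa [hγm, hmean0] using hinit
    | succ j ih =>
      have hrec : α ^ (2 * (j + 1)) * (γ - ((m + 2 : ℕ) : ℝ)) + ((m + 2 : ℕ) : ℝ) =
          α ^ 2 * (α ^ (2 * j) * (γ - ((m + 2 : ℕ) : ℝ)) + ((m + 2 : ℕ) : ℝ)) +
            (1 - α ^ 2) * ((m + 2 : ℕ) : ℝ) := by ring
      have hi := ih.1
      rw [hrec, lintegral_rxPower_succ hmodel hsel hα0 hα1 (by omega), ih.2,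
        ← ENNReal.ofReal_mul (by positivity), ← ENNReal.ofReal_add (by positivity) (by positivity)]
      exact ⟨by positivity, rfl⟩
  refine ⟨fun k hk => ?_, isPhi_phiIntegral, fun φ hφ => ?_⟩
  -- With `k = j + 1` the truncated subtraction `2 * k - 2` is `2 * j`.
  · obtain ⟨j, rfl⟩ := Nat.exists_eq_add_of_le' hk
    rw [show 2 * (j + 1) - 2 = 2 * j by omega]
    exact hintegral hk (hpow j).1 (hpow j).2
  · obtain ⟨h1, h2, h3, h4⟩ := hφ.eq_on isPhi_phiIntegral m
    rw [hγm, meanPower, ← hn, ← h1, ← h2, ← h3, ← h4]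
    rfl
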